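/- Let $p$ be a prime and $R$ a commutative ring with $pR=0$. Let $R^{(1)}$ be the group $R$ with the $R$-module structure $r\cdot r'=r^pr'$, regarded as an $R$-bimodule with equal left and right actions; for a finitely generated projective $R$-module $V$ put $V^{(1)}=R^{(1)}\otimes_RV$ and $\mathrm{Fr}:V\to V^{(1)}$, $v\mapsto 1\otimes v$. Let $\sigma$ be the cyclic permutation of order $p$ of $V^{\otimes_R p}$, let $\mathrm{tr}=1+\sigma+\dots+\sigma^{p-1}:(V^{\otimes p})_\sigma\to(V^{\otimes p})^\sigma$, let $\psi:V^{(1)}\to(V^{\otimes p})_\sigma$ be $r\otimes v\mapsto r[v^{\otimes p}]$, and let $\widehat\psi:(V^{\otimes p})^\sigma\to V^{(1)}$ be the transpose of the map $\psi$ for the dual module $V^*$. On $(V^{\otimes p})_\sigma$ and $(V^{\otimes p})^\sigma$ let $R$ act through the Frobenius map $r\mapsto r^p$, and set $$C_1(V)=(V^{\otimes p})_\sigma,\qquad C_0(V)=(V^{\otimes p})^\sigma\times_{V^{(1)}}V$$ (fibre product over $\widehat\psi$ and $\mathrm{Fr}$), $b=\psi$, $d(x)=(\mathrm{tr}\,x,0)$,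 $a(x,v)=v$. Then: (1) $C_0$ and $C_1$ are functors of $V$ that send $0$ to $0$, and $$0\to V^{(1)}\xrightarrow{\ b\ }C_1(V)\xrightarrow{\ d\ }C_0(V)\xrightarrow{\ a\ }V\to0$$ is exact and functorial in $V$; that is, $\langle C_\bullet,a,b\rangle$ is an elementary extension $\phi$ of $R$ by $R^{(1)}$. (2) The square-zero extension of $R$ by $R^{(1)}$ corresponding to $\phi$ is isomorphic to the ring $W_2(R)$ of second Witt vectors. In detail: $W_2(R)$, with $R^{(1)}\to W_2(R)$, $x\mapsto(0,x)$, and $W_2(R)\to R$, $(x_0,x_1)\mapsto x_0$, is a square-zero extension of $R$ by $R^{(1)}$. There is a splitting of $\phi$ over abelian groups, that is, a functor $C_{01}$ from finitely generated projective $R$-modules to abelian groups, with $C_{01}(0)=0$, and natural additive maps $c_1:C_1\to C_{01}$, $c_0:C_{01}\to C_0$ with $c_0c_1=d$, $c_1$ injective, $c_0$ surjective and $c_0^{-1}(\mathrm{Im}\,d)=\mathrm{Im}\,c_1$. For every such splitting let $R'$ be the ring of those natural additive endomorphisms $r'$ of $C_{01}$ for which there is $r\in R$ with $r'c_1=c_1r$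 and $c_0r'=rc_0$. There is a ring homomorphism $q:R'\to R$ such that $r=q(r')$ satisfies these two equations for every $r'\in R'$; with it and the map $i:R^{(1)}\to R'$, $i(m)=c_1\circ b\circ(m\otimes-)\circ a\circ c_0$, the ring $R'$ is a square-zero extension of $R$ by $R^{(1)}$, and there is a ring isomorphism $R'\cong W_2(R)$ that is compatible with the maps from $R^{(1)}$ and the maps to $R$. -/

import Mathlib

open CategoryTheory TensorProduct

namespace CyclicPower

universe u v w

/-! ### Finitely generated projective modules and pointed functors -/

section Functors

/-- The category `R-proj` of finitely generated projective `R`-modules. -/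
abbrev RProj (R : Type u) [CommRing R] :=
  ObjectProperty.FullSubcategory
    (fun V : ModuleCat.{u} R => Module.Finite R V ∧ Module.Projective R V)

/-- The functor `I : R-proj ⥤ R-mod`, the tautological embedding. -/
abbrev idFunctor (R : Type u) [CommRing R] : RProj R ⥤ ModuleCat.{u} R :=
  ObjectProperty.ι _

/-- The functor `I(M) : V ↦ M ⊗_R V` from `R-proj` to `R-mod`, for a diagonal `R`-bimodule `M`
(that is, an `R`-module `M` over the commutative ring `R`, acting in the same way on both sides). -/
noncomputable def tensorFunctor (R : Type u) [CommRing R] (M : Type u) [AddCommGroup M]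
    [Module R M] : RProj R ⥤ ModuleCat.{u} R where
  obj V := ModuleCat.of R (M ⊗[R] V.obj)
  map f := ModuleCat.ofHom (LinearMap.lTensor M f.hom.hom)
  map_id V := by
    ext : 1
    exact LinearMap.lTensor_id M V.obj
  map_comp f g := by
    ext : 1
    exact LinearMap.lTensor_comp M g.hom.hom f.hom.hom

/-- A functor on `R-proj` is pointed if it sends zero objects to zero objects. -/
def IsPointed {R : Type u} [CommRing R] {D : Type v} [Category.{w} D] (F : RProj R ⥤ D) : Prop :=
  ∀ V : RProj R, Limits.IsZero V → Limits.IsZero (F.obj V)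

/-- The forgetful functor `e_*` from `R`-modules to abelian groups. -/
abbrev forgetAb (R : Type u) [CommRing R] : ModuleCat.{u} R ⥤ AddCommGrpCat.{u} :=
  forget₂ (ModuleCat.{u} R) AddCommGrpCat.{u}

/-- The natural transformation `I ⟶ I(M)`, `v ↦ m ⊗ v`, attached to `m : M`. -/
noncomputable def tmulLeft (R : Type u) [CommRing R] {M : Type u} [AddCommGroup M]
    [Module R M] (m : M) : idFunctor R ⟶ tensorFunctor R M where
  app V := ModuleCat.ofHom (TensorProduct.mk R M V.obj m)
  naturality V W f := by
    ext v
    rfl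

end Functors

/-! ### Elementary extensions and their splittings -/

section Extensions

/-- The data of a sequence `0 ⟶ I(M) --b--> C₁ --d--> C₀ --a--> I ⟶ 0` of functors
`R-proj ⥤ R-mod` with zero composites. -/
structure FourTerm (R : Type u) [CommRing R] (M : Type u) [AddCommGroup M] [Module R M] where
  C₁ : RProj R ⥤ ModuleCat.{u} R
  C₀ : RProj R ⥤ ModuleCat.{u} R
  b : tensorFunctor R M ⟶ C₁
  d : C₁ ⟶ C₀
  a : C₀ ⟶ idFunctor R
  b_d : b ≫ d = 0
  d_a : d ≫ a = 0

/-- The sequence is an elementary extension of `R` by `M`: `C₁`, `C₀` are pointed functors and the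
four-term sequence is exact (exactness in a category of functors is checked objectwise). -/
structure FourTerm.IsElementaryExtension {R : Type u} [CommRing R] {M : Type u} [AddCommGroup M]
    [Module R M] (φ : FourTerm R M) : Prop where
  pointed₁ : IsPointed φ.C₁
  pointed₀ : IsPointed φ.C₀
  injective_b : ∀ V, Function.Injective (φ.b.app V).hom
  exact_b_d : ∀ V, Function.Exact (φ.b.app V).hom (φ.d.app V).hom
  exact_d_a : ∀ V, Function.Exact (φ.d.app V).hom (φ.a.app V).hom
  surjective_a : ∀ V, Function.Surjective (φ.a.app V).hom

/-- A splitting of the elementary extension `e_*(φ)` of functors from `R-proj` to abelian groups: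
a pointed functor `C₀₁` with maps `c₁ : C₁ ⟶ C₀₁` and `c₀ : C₀₁ ⟶ C₀` such that `c₀ ∘ c₁ = d`, the
square formed by `C₁ ⟶ C₀₁`, `Im d ⟶ C₀` is cartesian, and `c₀` is surjective. Equivalently, `C₀₁`
is filtered with `W₁ = C₁` and `C₀₁ / W₀ = C₀`, where `W₀ = I(M) ⊆ C₁`. -/
structure Splitting {R : Type u} [CommRing R] {M : Type u} [AddCommGroup M] [Module R M]
    (φ : FourTerm R M) where
  C₀₁ : RProj R ⥤ AddCommGrpCat.{u}
  pointed : IsPointed C₀₁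
  c₁ : φ.C₁ ⋙ forgetAb R ⟶ C₀₁
  c₀ : C₀₁ ⟶ φ.C₀ ⋙ forgetAb R
  comm : c₁ ≫ c₀ = Functor.whiskerRight φ.d (forgetAb R)
  injective_c₁ : ∀ V, Function.Injective (c₁.app V).hom
  cartesian : ∀ (V : RProj R) (x : C₀₁.obj V),
    (∃ y : φ.C₁.obj V, (c₀.app V).hom x = (φ.d.app V).hom y) → ∃ y, (c₁.app V).hom y = x
  surjective_c₀ : ∀ V, Function.Surjective (c₀.app V).hom

namespace Splitting

variable {R : Type u} [CommRing R] {M : Type u} [AddCommGroup M] [Module R M] {φ : FourTerm R M}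

/-- The endomorphism `f` of `C₀₁` is compatible, via `c₁` and `c₀`, with the multiplication by
`r` on `C₁` and on `C₀`. -/
def IsRegularWith (S : Splitting φ) (r : R) (f : End S.C₀₁) : Prop :=
  S.c₁ ≫ (show S.C₀₁ ⟶ S.C₀₁ from f) =
      Functor.whiskerRight (r • 𝟙 φ.C₁) (forgetAb R) ≫ S.c₁ ∧
    (show S.C₀₁ ⟶ S.C₀₁ from f) ≫ S.c₀ =
      S.c₀ ≫ Functor.whiskerRight (r • 𝟙 φ.C₀) (forgetAb R)

/-- The ring `R'` of regular endomorphisms of `C₀₁`: those compatible with the multiplication by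
some element `r : R`. -/
def regularEnd (S : Splitting φ) : Subring (End S.C₀₁) where
  carrier := {f | ∃ r : R, S.IsRegularWith r f}
  mul_mem' := by
    rintro f g ⟨r, hr₁, hr₀⟩ ⟨s, hs₁, hs₀⟩
    refine ⟨r * s, ?_, ?_⟩
    · have h : (r * s) • 𝟙 φ.C₁ = (s • 𝟙 φ.C₁) ≫ (r • 𝟙 φ.C₁) := by
        simp [smul_smul]
      rw [h, Functor.whiskerRight_comp, Category.assoc, ← hr₁, ← Category.assoc, ← hs₁,
        Category.assoc]
      rfl
    · have h : (r * s) • 𝟙 φ.C₀ = (s • 𝟙 φ.C₀) ≫ (r • 𝟙 φ.C₀) := by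
        simp [smul_smul]
      rw [h, Functor.whiskerRight_comp, ← Category.assoc, ← hs₀, Category.assoc, ← hr₀,
        ← Category.assoc]
      rfl
  one_mem' := by
    refine ⟨1, ?_, ?_⟩
    · rw [one_smul, Functor.whiskerRight_id']
      exact (Category.comp_id _).trans (Category.id_comp _).symm
    · rw [one_smul, Functor.whiskerRight_id']
      exact (Category.id_comp _).trans (Category.comp_id _).symm
  add_mem' := by
    rintro f g ⟨r, hr₁, hr₀⟩ ⟨s, hs₁, hs₀⟩
    refine ⟨r + s, ?_, ?_⟩
    · have h : Functor.whiskerRight ((r + s) • 𝟙 φ.C₁) (forgetAb R) =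
          Functor.whiskerRight (r • 𝟙 φ.C₁) (forgetAb R) +
            Functor.whiskerRight (s • 𝟙 φ.C₁) (forgetAb R) := by
        rw [add_smul]; rfl
      rw [h, Preadditive.add_comp, ← hr₁, ← hs₁]
      exact Preadditive.comp_add _ _ _ S.c₁ f g
    · have h : Functor.whiskerRight ((r + s) • 𝟙 φ.C₀) (forgetAb R) =
          Functor.whiskerRight (r • 𝟙 φ.C₀) (forgetAb R) +
            Functor.whiskerRight (s • 𝟙 φ.C₀) (forgetAb R) := by
        rw [add_smul]; rfl
      rw [h, Preadditive.comp_add, ← hr₀, ← hs₀]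
      exact Preadditive.add_comp _ _ _ f g S.c₀
  zero_mem' := by
    refine ⟨0, ?_, ?_⟩
    · have h : Functor.whiskerRight ((0 : R) • 𝟙 φ.C₁) (forgetAb R) = 0 := by
        rw [zero_smul]; rfl
      rw [h, Limits.zero_comp]
      exact Limits.comp_zero
    · have h : Functor.whiskerRight ((0 : R) • 𝟙 φ.C₀) (forgetAb R) = 0 := by
        rw [zero_smul]; rfl
      rw [h, Limits.comp_zero]
      exact Limits.zero_comp
  neg_mem' := by
    rintro f ⟨r, hr₁, hr₀⟩
    refine ⟨-r, ?_, ?_⟩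
    · have h : Functor.whiskerRight ((-r) • 𝟙 φ.C₁) (forgetAb R) =
          -Functor.whiskerRight (r • 𝟙 φ.C₁) (forgetAb R) := by
        rw [neg_smul]; rfl
      rw [h, Preadditive.neg_comp, ← hr₁]
      exact Preadditive.comp_neg _ _
    · have h : Functor.whiskerRight ((-r) • 𝟙 φ.C₀) (forgetAb R) =
          -Functor.whiskerRight (r • 𝟙 φ.C₀) (forgetAb R) := by
        rw [neg_smul]; rfl
      rw [h, Preadditive.comp_neg, ← hr₀]
      exact Preadditive.neg_comp _ _

/-- The endomorphism of `C₀₁` attached to `m : M`, namely the composite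
`C₀₁ --c₀--> C₀ --a--> I --(v ↦ m ⊗ v)--> I(M) --b--> C₁ --c₁--> C₀₁`. -/
noncomputable def inclEnd (S : Splitting φ) (m : M) : End S.C₀₁ :=
  S.c₀ ≫ Functor.whiskerRight (φ.a ≫ tmulLeft R m ≫ φ.b) (forgetAb R) ≫ S.c₁

theorem inclEnd_isRegularWith (S : Splitting φ) (m : M) :
    S.IsRegularWith 0 (S.inclEnd m) := by
  constructor
  · have h : Functor.whiskerRight ((0 : R) • 𝟙 φ.C₁) (forgetAb R) = 0 := by
      rw [zero_smul]; rfl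
    have h' : Functor.whiskerRight (φ.d ≫ φ.a ≫ tmulLeft R m ≫ φ.b) (forgetAb R) = 0 := by
      rw [reassoc_of% φ.d_a, Limits.zero_comp]; rfl
    rw [Functor.whiskerRight_comp, ← S.comm, Category.assoc] at h'
    have h'' := congrArg (fun t => t ≫ S.c₁) h'
    simp only [Category.assoc, Limits.zero_comp] at h''
    rw [h, Limits.zero_comp]
    exact h''
  · have h : Functor.whiskerRight ((0 : R) • 𝟙 φ.C₀) (forgetAb R) = 0 := by
      rw [zero_smul]; rfl
    have h' : Functor.whiskerRight (φ.a ≫ tmulLeft R m ≫ φ.b ≫ φ.d) (forgetAb R) = 0 := by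
      rw [φ.b_d, Limits.comp_zero, Limits.comp_zero]; rfl
    rw [← Category.assoc (tmulLeft R m), ← Category.assoc φ.a, Functor.whiskerRight_comp,
      ← S.comm] at h'
    have h'' := congrArg (fun t => S.c₀ ≫ t) h'
    simp only [Limits.comp_zero] at h''
    rw [h, Limits.comp_zero]
    dsimp only [inclEnd]
    simp only [Category.assoc]
    exact h''

/-- The map `M → R'`, `m ↦ c₁ ∘ b ∘ (m ⊗ -) ∘ a ∘ c₀`. -/
noncomputable def incl (S : Splitting φ) : M →+ S.regularEnd where
  toFun m := ⟨S.inclEnd m, 0, S.inclEnd_isRegularWith m⟩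
  map_zero' := by
    refine Subtype.ext ?_
    have h : Functor.whiskerRight (φ.a ≫ tmulLeft R (0 : M) ≫ φ.b) (forgetAb R) = 0 := by
      have h0 : tmulLeft R (0 : M) = 0 := by
        ext V v
        exact TensorProduct.zero_tmul M v
      rw [h0, Limits.zero_comp, Limits.comp_zero]; rfl
    change S.c₀ ≫ _ ≫ S.c₁ = 0
    rw [h, Limits.zero_comp, Limits.comp_zero]
  map_add' m m' := by
    refine Subtype.ext ?_
    have h : Functor.whiskerRight (φ.a ≫ tmulLeft R (m + m') ≫ φ.b) (forgetAb R) =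
        Functor.whiskerRight (φ.a ≫ tmulLeft R m ≫ φ.b) (forgetAb R) +
          Functor.whiskerRight (φ.a ≫ tmulLeft R m' ≫ φ.b) (forgetAb R) := by
      have h0 : tmulLeft R (m + m') = tmulLeft R m + tmulLeft R m' := by
        ext V v
        exact TensorProduct.add_tmul m m' v
      rw [h0, Preadditive.add_comp, Preadditive.comp_add]; rfl
    change S.c₀ ≫ _ ≫ S.c₁ = S.c₀ ≫ _ ≫ S.c₁ + S.c₀ ≫ _ ≫ S.c₁
    rw [h, Preadditive.add_comp, Preadditive.comp_add]

end Splitting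

/-- The maps `i : M → A` and `q : A → R` make the ring `A` a square-zero extension of the
commutative ring `R` by the diagonal bimodule `M`. -/
structure IsSquareZeroExtension {R : Type u} [CommRing R] {M : Type v} [AddCommGroup M]
    [Module R M] {A : Type w} [Ring A] (i : M →+ A) (q : A →+* R) : Prop where
  injective : Function.Injective i
  exact : Function.Exact i q
  surjective : Function.Surjective q
  right_mul : ∀ (m : M) (x : A), i m * x = i (q x • m)
  left_mul : ∀ (m : M) (x : A), x * i m = i (q x • m)
  sq_zero : ∀ m m' : M, i m * i m' = 0

end Extensions

/-! ### The Frobenius twist -/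

section Twist

variable {p : ℕ} [Fact p.Prime] {R : Type u} [CommRing R]

/-- The Frobenius endomorphism `r ↦ r ^ p` of a commutative ring annihilated by the prime `p`
(the zero ring is allowed). -/
def frob (hR : (p : R) = 0) : R →+* R where
  toFun r := r ^ p
  map_one' := one_pow p
  map_mul' r s := mul_pow r s p
  map_zero' := zero_pow (Fact.out : p.Prime).ne_zero
  map_add' r s := by
    obtain ⟨t, ht⟩ := exists_add_pow_prime_eq (Fact.out : p.Prime) r s
    rw [ht, hR]
    ring

/-- The `R`-module obtained from an `R`-module `X` by restriction of scalars along the Frobenius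
map: the group `X` with `r • x = r ^ p * x`. In particular `Twist hR R` is the module `R^{(1)}`. -/
def Twist (_hR : (p : R) = 0) (X : Type u) : Type u := X

instance (hR : (p : R) = 0) (X : Type u) [AddCommGroup X] : AddCommGroup (Twist hR X) :=
  inferInstanceAs (AddCommGroup X)

instance (hR : (p : R) = 0) (X : Type u) [AddCommGroup X] [Module R X] : Module R (Twist hR X) :=
  Module.compHom X (frob hR)

/-- The identity map of `X`, as an additive map to the twist. -/
def toTwist (hR : (p : R) = 0) (X : Type u) [AddCommGroup X] : X ≃+ Twist hR X :=
  AddEquiv.refl X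

theorem smul_toTwist (hR : (p : R) = 0) {X : Type u} [AddCommGroup X] [Module R X] (r : R)
    (x : X) : r • toTwist hR X x = toTwist hR X (r ^ p • x) := rfl

/-- An `R`-linear map remains linear between the twists. -/
def twistMap (hR : (p : R) = 0) {X Y : Type u} [AddCommGroup X] [Module R X] [AddCommGroup Y]
    [Module R Y] (f : X →ₗ[R] Y) : Twist hR X →ₗ[R] Twist hR Y where
  toFun x := toTwist hR Y (f ((toTwist hR X).symm x))
  map_add' x y := by simp
  map_smul' r x := f.map_smul (r ^ p) x

end Twist

/-! ### Cyclic powers -/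

section Cyclic

/-- A rotation-invariant function on subsets of `Fin p`, with values in a group annihilated by
`p`, sums to the sum of its values at the two fixed points. -/
theorem sum_rotation {p : ℕ} [Fact p.Prime] {A : Type*} [AddCommGroup A]
    (hA : ∀ x : A, p • x = 0) (g : Finset (Fin p) → A)
    (hg : ∀ S, g (S.map (finRotate p).toEmbedding) = g S) :
    ∑ S : Finset (Fin p), g S = g ∅ + g Finset.univ := by
  have hp : p.Prime := Fact.out
  have key : ∀ k, 0 < k → k < p →
      ∑ S ∈ Finset.powersetCard k (Finset.univ : Finset (Fin p)), g S = 0 := by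
    intro k hk0 hkp
    set T := ∑ S ∈ Finset.powersetCard k (Finset.univ : Finset (Fin p)), g S with hT
    let N : Fin p → A := fun i =>
      ∑ S ∈ Finset.powersetCard k (Finset.univ : Finset (Fin p)), if i ∈ S then g S else 0
    have h1 : k • T = ∑ i, N i := by
      rw [hT, Finset.smul_sum, Finset.sum_comm]
      refine Finset.sum_congr rfl fun S hS => ?_
      rw [← Finset.sum_filter, Finset.sum_const]
      congr 1
      rw [Finset.filter_mem_eq_inter, Finset.univ_inter]
      exact (Finset.mem_powersetCard.1 hS).2.symm
    have h2 : ∀ i, N (finRotate p i) = N i := by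
      intro i
      refine (Finset.sum_bij (fun S _ => S.map (finRotate p).toEmbedding) ?_ ?_ ?_ ?_).symm
      · intro S hS
        rw [Finset.mem_powersetCard] at hS ⊢
        exact ⟨Finset.subset_univ _, by rw [Finset.card_map]; exact hS.2⟩
      · intro S _ S' _ h
        exact Finset.map_injective _ h
      · intro S hS
        refine ⟨S.map (finRotate p).symm.toEmbedding, ?_, ?_⟩
        · rw [Finset.mem_powersetCard] at hS ⊢
          exact ⟨Finset.subset_univ _, by rw [Finset.card_map]; exact hS.2⟩
        · ext j
          simp
      · intro S _
        rw [hg]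
        simp
    have : NeZero p := ⟨hp.ne_zero⟩
    have h3 : ∀ n : ℕ, N (Fin.ofNat p n) = N 0 := by
      intro n
      induction n with
      | zero => rfl
      | succ n ih =>
        rw [← ih, ← h2 (Fin.ofNat p n), finRotate_apply]
        congr 1
        ext
        simp [Fin.val_add]
    have h4 : ∀ i, N i = N 0 := fun i => by
      have := h3 i.val
      rwa [Fin.ofNat_val_eq_self] at this
    have h5 : k • T = 0 := by
      rw [h1, Finset.sum_congr rfl fun i _ => h4 i, Finset.sum_const, Finset.card_univ,
        Fintype.card_fin, hA]
    have h6 : IsCoprime (k : ℤ) (p : ℤ) :=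
      Nat.isCoprime_iff_coprime.2 (Nat.Coprime.symm
      ((Nat.Prime.coprime_iff_not_dvd hp).2 fun h => absurd (Nat.le_of_dvd hk0 h) (by omega)))
    obtain ⟨a, b, hab⟩ := h6
    calc T = (a * k + b * p) • T := by rw [hab, one_smul]
      _ = a • (k • T) + b • (p • T) := by
        rw [add_smul, mul_smul, mul_smul, natCast_zsmul, natCast_zsmul]
      _ = 0 := by rw [h5, hA]; simp
  rw [← Finset.powerset_univ, Finset.sum_powerset, Finset.card_univ, Fintype.card_fin,
    Finset.sum_range_succ]
  obtain ⟨n, rfl⟩ : ∃ n, p = n + 1 := ⟨p - 1, by have := hp.pos; omega⟩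
  rw [Finset.sum_range_succ', Finset.sum_eq_zero]
  · rw [zero_add]
    congr 1
    · simp
    · have : Finset.powersetCard (n + 1) (Finset.univ : Finset (Fin (n + 1))) = {Finset.univ} := by
        have := Finset.powersetCard_self (Finset.univ : Finset (Fin (n + 1)))
        rwa [Finset.card_univ, Fintype.card_fin] at this
      rw [this, Finset.sum_singleton]
  · intro k hk
    rw [Finset.mem_range] at hk
    exact key (k + 1) (by omega) (by omega)

theorem finRotate_pow_self (p : ℕ) : finRotate p ^ p = 1 := by
  rcases p with _ | _ | p
  · rfl
  · exact Equiv.ext fun i => Subsingleton.elim (α := Fin 1) _ _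
  · have h := pow_orderOf_eq_one (finRotate (p + 2))
    rwa [← Equiv.Perm.lcm_cycleType, cycleType_finRotate, Multiset.lcm_singleton,
      normalize_eq] at h

variable (p : ℕ) {R : Type u} [CommRing R]

section Defs

variable (R) (V : Type u) [AddCommGroup V] [Module R V]

/-- The order-`p` permutation `σ : V^{⊗ p} → V^{⊗ p}` of the tensor factors. -/
noncomputable def sigma : (⨂[R]^p V) →ₗ[R] (⨂[R]^p V) :=
  (PiTensorProduct.reindex R (fun _ => V) (finRotate p)).toLinearMap

/-- The map `tr = id + σ + ⋯ + σ^{p-1}` on `V^{⊗ p}`. -/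
noncomputable def traceEnd : (⨂[R]^p V) →ₗ[R] (⨂[R]^p V) :=
  ∑ i ∈ Finset.range p, sigma p R V ^ i

/-- The endomorphism `id - σ` of `V^{⊗ p}`. -/
noncomputable def oneSubSigma : (⨂[R]^p V) →ₗ[R] (⨂[R]^p V) :=
  LinearMap.id - sigma p R V

/-- The module of coinvariants `(V^{⊗ p})_σ`. -/
abbrev Coinv : Type u := (⨂[R]^p V) ⧸ LinearMap.range (oneSubSigma p R V)

/-- The module of invariants `(V^{⊗ p})^σ`. -/
noncomputable abbrev Inv : Submodule R (⨂[R]^p V) := LinearMap.ker (oneSubSigma p R V)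

variable {R V}

theorem sigma_tprod (v : Fin p → V) :
    sigma p R V (PiTensorProduct.tprod R v) =
      PiTensorProduct.tprod R (fun i => v ((finRotate p).symm i)) :=
  PiTensorProduct.reindex_tprod _ _

variable (R V)

theorem sigma_pow_self : sigma p R V ^ p = 1 := by
  have h : ∀ k : ℕ, ∀ v : Fin p → V, (sigma p R V ^ k) (PiTensorProduct.tprod R v) =
      PiTensorProduct.tprod R (fun i => v (((finRotate p) ^ k).symm i)) := by
    intro k
    induction k with
    | zero => intro v; rfl
    | succ k ih =>
      intro v
      rw [pow_succ, Module.End.mul_apply, sigma_tprod, ih, pow_succ (finRotate p)]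
      rfl
  refine PiTensorProduct.ext (MultilinearMap.ext fun v => ?_)
  change (sigma p R V ^ p) (PiTensorProduct.tprod R v) = PiTensorProduct.tprod R v
  rw [h, finRotate_pow_self]
  rfl

theorem traceEnd_comp : traceEnd p R V ∘ₗ oneSubSigma p R V = 0 := by
  have h := geom_sum_mul (sigma p R V) p
  rw [sigma_pow_self, sub_self] at h
  refine LinearMap.ext fun x => ?_
  have h' : traceEnd p R V (sigma p R V x - x) = 0 := LinearMap.congr_fun h x
  change traceEnd p R V (x - sigma p R V x) = 0
  rw [← neg_sub, map_neg, h', neg_zero]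

theorem comp_traceEnd : oneSubSigma p R V ∘ₗ traceEnd p R V = 0 := by
  have h := mul_geom_sum (sigma p R V) p
  rw [sigma_pow_self, sub_self] at h
  refine LinearMap.ext fun x => ?_
  have h' : sigma p R V (traceEnd p R V x) - traceEnd p R V x = 0 := LinearMap.congr_fun h x
  change traceEnd p R V x - sigma p R V (traceEnd p R V x) = 0
  rw [← neg_sub, h', neg_zero]

/-- The trace map `tr : (V^{⊗ p})_σ → (V^{⊗ p})^σ`. -/
noncomputable def trace : Coinv p R V →ₗ[R] Inv p R V :=
  Submodule.liftQ _
    (LinearMap.codRestrict _ (traceEnd p R V)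
      (fun x => LinearMap.congr_fun (comp_traceEnd p R V) x))
    (by
      rintro _ ⟨x, rfl⟩
      exact Subtype.ext (LinearMap.congr_fun (traceEnd_comp p R V) x))

/-- The class of `v ⊗ ⋯ ⊗ v` in `(V^{⊗ p})_σ`. -/
noncomputable def powClass (v : V) : Coinv p R V :=
  Submodule.Quotient.mk (PiTensorProduct.tprod R (fun _ => v))

end Defs

section Maps

variable {V W X : Type u} [AddCommGroup V] [Module R V] [AddCommGroup W] [Module R W]
  [AddCommGroup X] [Module R X]

/-- The map `g^{⊗ p}`. -/
noncomputable def powMap (g : V →ₗ[R] W) : (⨂[R]^p V) →ₗ[R] (⨂[R]^p W) :=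
  PiTensorProduct.map (fun _ => g)

theorem powMap_sigma (g : V →ₗ[R] W) :
    powMap p g ∘ₗ sigma p R V = sigma p R W ∘ₗ powMap p g := by
  refine PiTensorProduct.ext (MultilinearMap.ext fun v => ?_)
  simp [powMap, sigma_tprod]

theorem powMap_id_sub_sigma (g : V →ₗ[R] W) (x : ⨂[R]^p V) :
    powMap p g (oneSubSigma p R V x) = oneSubSigma p R W (powMap p g x) := by
  have := LinearMap.congr_fun (powMap_sigma p g) x
  simp only [LinearMap.comp_apply] at this
  simp [oneSubSigma, this]

theorem powMap_traceEnd (g : V →ₗ[R] W) (x : ⨂[R]^p V) :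
    powMap p g (traceEnd p R V x) = traceEnd p R W (powMap p g x) := by
  have h : ∀ k : ℕ, ∀ x, powMap p g ((sigma p R V ^ k) x) = (sigma p R W ^ k) (powMap p g x) := by
    intro k
    induction k with
    | zero => intro x; rfl
    | succ k ih =>
      intro x
      rw [pow_succ, Module.End.mul_apply, ih, pow_succ, Module.End.mul_apply]
      congr 1
      exact LinearMap.congr_fun (powMap_sigma p g) x
  simp [traceEnd, h]

/-- Functoriality of the coinvariants. -/
noncomputable def coinvMap (g : V →ₗ[R] W) : Coinv p R V →ₗ[R] Coinv p R W :=
  Submodule.mapQ _ _ (powMap p g) (by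
    rintro _ ⟨x, rfl⟩
    exact ⟨powMap p g x, (powMap_id_sub_sigma p g x).symm⟩)

/-- Functoriality of the invariants. -/
noncomputable def invMap (g : V →ₗ[R] W) : Inv p R V →ₗ[R] Inv p R W :=
  (powMap p g).restrict (fun x hx => by
    rw [LinearMap.mem_ker] at hx ⊢
    rw [← powMap_id_sub_sigma, hx, map_zero])

theorem trace_coinvMap (g : V →ₗ[R] W) (x : Coinv p R V) :
    trace p R W (coinvMap p g x) = invMap p g (trace p R V x) := by
  obtain ⟨x, rfl⟩ := Submodule.Quotient.mk_surjective _ x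
  exact Subtype.ext (powMap_traceEnd p g x).symm

theorem powMap_id (x : ⨂[R]^p V) : powMap p (LinearMap.id : V →ₗ[R] V) x = x :=
  LinearMap.congr_fun PiTensorProduct.map_id x

theorem powMap_comp (h : W →ₗ[R] X) (g : V →ₗ[R] W) (x : ⨂[R]^p V) :
    powMap p (h ∘ₗ g) x = powMap p h (powMap p g x) :=
  LinearMap.congr_fun (PiTensorProduct.map_comp (fun _ => h) (fun _ => g)) x

/-- For a linear functional `f` on `V`, the functional `f^{⊗ p}` on `V^{⊗ p}`, with values in
`R = R^{⊗ p}`. -/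
noncomputable def powFun (f : V →ₗ[R] R) : (⨂[R]^p V) →ₗ[R] R :=
  PiTensorProduct.lift ((MultilinearMap.mkPiAlgebra R (Fin p) R).compLinearMap (fun _ => f))

theorem powFun_tprod (f : V →ₗ[R] R) (v : Fin p → V) :
    powFun p f (PiTensorProduct.tprod R v) = ∏ i, f (v i) := by
  simp [powFun]

theorem powFun_powMap (f : W →ₗ[R] R) (g : V →ₗ[R] W) (x : ⨂[R]^p V) :
    powFun p f (powMap p g x) = powFun p (f ∘ₗ g) x := by
  have : powFun p f ∘ₗ powMap p g = powFun p (f ∘ₗ g) := by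
    refine PiTensorProduct.ext (MultilinearMap.ext fun v => ?_)
    simp [powMap, powFun_tprod]
  exact LinearMap.congr_fun this x

theorem powFun_sigma (f : V →ₗ[R] R) (x : ⨂[R]^p V) :
    powFun p f (sigma p R V x) = powFun p f x := by
  have : powFun p f ∘ₗ sigma p R V = powFun p f := by
    refine PiTensorProduct.ext (MultilinearMap.ext fun v => ?_)
    simp only [LinearMap.compMultilinearMap_apply, LinearMap.comp_apply, sigma_tprod, powFun_tprod]
    exact Equiv.prod_comp (finRotate p).symm (fun i => f (v i))
  exact LinearMap.congr_fun this x

end Maps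

end Cyclic

/-! ### The maps `ψ` and `ψ̂` -/

section Psi


variable {p : ℕ} [Fact p.Prime] {R : Type u} [CommRing R] (hR : (p : R) = 0)
  {V W : Type u} [AddCommGroup V] [Module R V] [AddCommGroup W] [Module R W]

theorem nsmul_eq_zero_of (hR : (p : R) = 0) {X : Type*} [AddCommGroup X] [Module R X] (x : X) :
    p • x = 0 := by
  rw [← Nat.cast_smul_eq_nsmul R, hR, zero_smul]

theorem rotate_piecewise {X : Type*} (S : Finset (Fin p)) (v w : X) :
    (fun i => S.piecewise (fun _ => v) (fun _ => w) ((finRotate p).symm i)) =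
      (S.map (finRotate p).toEmbedding).piecewise (fun _ => v) (fun _ => w) := by
  funext i
  simp [Finset.piecewise, Finset.mem_map_equiv]

theorem powClass_add (hR : (p : R) = 0) (v w : V) :
    powClass p R V (v + w) = powClass p R V v + powClass p R V w := by
  have h := (PiTensorProduct.tprod R (s := fun _ : Fin p => V)).map_add_univ
    (fun _ => v) (fun _ => w)
  have h' := sum_rotation (nsmul_eq_zero_of hR (X := Coinv p R V))
    (fun S => Submodule.Quotient.mk
      (PiTensorProduct.tprod R (S.piecewise (fun _ => v) (fun _ => w)))) (by
    intro S
    refine Eq.symm ((Submodule.Quotient.eq (LinearMap.range (oneSubSigma p R V))).2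
      (LinearMap.mem_range.2
        ⟨PiTensorProduct.tprod R (S.piecewise (fun _ => v) (fun _ => w)), ?_⟩))
    change _ - sigma p R V _ = _
    rw [sigma_tprod, rotate_piecewise]
    rfl)
  have h0 : powClass p R V (v + w) = ∑ S : Finset (Fin p), Submodule.Quotient.mk
      (PiTensorProduct.tprod R (S.piecewise (fun _ => v) (fun _ => w))) := by
    have := congrArg (LinearMap.range (oneSubSigma p R V)).mkQ h
    rw [map_sum] at this
    exact this
  rw [h0, h', add_comm]
  simp [powClass]

theorem powClass_smul (r : R) (v : V) :
    powClass p R V (r • v) = r ^ p • powClass p R V v := by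
  have h := (PiTensorProduct.tprod R (s := fun _ : Fin p => V)).map_smul_univ
    (fun _ => r) (fun _ => v)
  rw [Finset.prod_const, Finset.card_univ, Fintype.card_fin] at h
  exact congrArg (LinearMap.range (oneSubSigma p R V)).mkQ h

theorem powFun_add (hR : (p : R) = 0) (f g : V →ₗ[R] R) (x : ⨂[R]^p V) (hx : x ∈ Inv p R V) :
    powFun p (f + g) x = powFun p f x + powFun p g x := by
  let F (S : Finset (Fin p)) : (⨂[R]^p V) →ₗ[R] R := PiTensorProduct.lift
    ((MultilinearMap.mkPiAlgebra R (Fin p) R).compLinearMap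
      (S.piecewise (fun _ => f) (fun _ => g)))
  have hF : ∀ S (v : Fin p → V), F S (PiTensorProduct.tprod R v) =
      ∏ i, S.piecewise (fun _ => f) (fun _ => g) i (v i) := by
    intro S v
    simp [F]
  have h1 : powFun p (f + g) = ∑ S : Finset (Fin p), F S := by
    refine PiTensorProduct.ext (MultilinearMap.ext fun v => ?_)
    simp only [LinearMap.compMultilinearMap_apply, powFun_tprod, LinearMap.add_apply,
      LinearMap.sum_apply, hF, Finset.prod_add]
    rw [Finset.powerset_univ]
    refine Finset.sum_congr rfl fun S _ => ?_
    rw [← Finset.prod_mul_prod_compl S]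
    congr 1
    · exact Finset.prod_congr rfl fun i hi => by simp [hi]
    · rw [Finset.compl_eq_univ_sdiff]
      exact Finset.prod_congr rfl fun i hi => by
        rw [Finset.piecewise_eq_of_notMem _ _ _ (Finset.mem_sdiff.1 hi).2]
  have h2 : ∀ S, F (S.map (finRotate p).toEmbedding) ∘ₗ sigma p R V = F S := by
    intro S
    refine PiTensorProduct.ext (MultilinearMap.ext fun v => ?_)
    simp only [LinearMap.compMultilinearMap_apply, LinearMap.comp_apply, sigma_tprod, hF]
    rw [← rotate_piecewise]
    exact Equiv.prod_comp (finRotate p).symm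
      (fun i => S.piecewise (fun _ => f) (fun _ => g) i (v i))
  have hx' : sigma p R V x = x := by
    have : x - sigma p R V x = 0 := hx
    exact (sub_eq_zero.1 this).symm
  have h3 := sum_rotation (nsmul_eq_zero_of hR (X := R)) (fun S => F S x) (by
    intro S
    have := LinearMap.congr_fun (h2 S) x
    rwa [LinearMap.comp_apply, hx'] at this)
  rw [h1, LinearMap.sum_apply, h3, add_comm]
  simp [F, powFun]

theorem powFun_smul (r : R) (f : V →ₗ[R] R) (x : ⨂[R]^p V) :
    powFun p (r • f) x = r ^ p * powFun p f x := by
  have : powFun p (r • f) = r ^ p • powFun p f := by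
    refine PiTensorProduct.ext (MultilinearMap.ext fun v => ?_)
    simp [powFun_tprod, Finset.prod_mul_distrib]
  exact LinearMap.congr_fun this x

/-- The twist `V^{(1)} = R^{(1)} ⊗_R V`. -/
abbrev VTwist (V : Type u) [AddCommGroup V] [Module R V] : Type u := Twist hR R ⊗[R] V

/-- The Frobenius map `Fr : V → V^{(1)}`, obtained by tensoring `R → R^{(1)}`, `r ↦ r ^ p = r • 1`,
with `V`. -/
noncomputable def frobMap (V : Type u) [AddCommGroup V] [Module R V] : V →ₗ[R] VTwist hR V :=
  TensorProduct.mk R (Twist hR R) V (toTwist hR R 1)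

/-- The map `ψ : V^{(1)} → (V^{⊗ p})_σ`, `r ⊗ v ↦ r [v ⊗ ⋯ ⊗ v]`. It is linear when `R` acts on the
target through the Frobenius map. -/
noncomputable def psi (V : Type u) [AddCommGroup V] [Module R V] :
    VTwist hR V →ₗ[R] Twist hR (Coinv p R V) :=
  TensorProduct.lift (LinearMap.mk₂ R
    (fun (r : Twist hR R) (v : V) =>
      toTwist hR (Coinv p R V) ((toTwist hR R).symm r • powClass p R V v))
    (fun r s v => by simp [add_smul])
    (fun c r v => by
      obtain ⟨r, rfl⟩ := (toTwist hR R).surjective r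
      simp [smul_toTwist, mul_smul])
    (fun r v w => by simp [powClass_add hR])
    (fun c r v => by
      simp only [powClass_smul, smul_toTwist]
      rw [smul_comm]))

/-- For a functional `f : V → R`, the functional `f^{(1)} : V^{(1)} → R^{(1)}`,
`r ⊗ v ↦ r * f(v) ^ p`. -/
noncomputable def twistFun (f : V →ₗ[R] R) : VTwist hR V →ₗ[R] Twist hR R :=
  (TensorProduct.rid R (Twist hR R)).toLinearMap ∘ₗ LinearMap.lTensor (Twist hR R) f

theorem twistFun_tmul (f : V →ₗ[R] R) (r : R) (v : V) :
    twistFun hR f (toTwist hR R r ⊗ₜ[R] v) = toTwist hR R (f v ^ p * r) := by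
  simp [twistFun, smul_toTwist]

/-- Functionals of the form `f^{(1)}` separate the points of `V^{(1)}`. -/
theorem twistFun_ext [Module.Finite R V] [Module.Projective R V] {y z : VTwist hR V}
    (h : ∀ f : V →ₗ[R] R, twistFun hR f y = twistFun hR f z) : y = z := by
  obtain ⟨n, e, g, -, -, heg⟩ := Module.Finite.exists_comp_eq_id_of_projective R V
  have key : ∀ y : VTwist hR V,
      y = ∑ i : Fin n, twistFun hR (LinearMap.proj i ∘ₗ g) y ⊗ₜ[R] e (Pi.single i 1) := by
    intro y
    induction y using TensorProduct.induction_on with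
    | zero => simp
    | add y z hy hz =>
      conv_lhs => rw [hy, hz]
      simp [TensorProduct.add_tmul, Finset.sum_add_distrib]
    | tmul r v =>
      have hv : v = ∑ i : Fin n, g v i • e (Pi.single i 1) := by
        have h1 : e (g v) = v := LinearMap.congr_fun heg v
        conv_lhs => rw [← h1, pi_eq_sum_univ' (g v)]
        simp
      conv_lhs => rw [hv, TensorProduct.tmul_sum]
      refine Finset.sum_congr rfl fun i _ => ?_
      rw [← TensorProduct.smul_tmul]
      simp [twistFun]
  rw [key y, key z]
  simp [h]

/-- Existence of the transpose of `ψ`. -/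
theorem exists_psiHat (V : Type u) [AddCommGroup V] [Module R V] [Module.Finite R V]
    [Module.Projective R V] :
    ∃ ψ : Twist hR (Inv p R V) →ₗ[R] VTwist hR V, ∀ (f : V →ₗ[R] R) (x : Inv p R V),
      twistFun hR f (ψ (toTwist hR _ x)) = toTwist hR R (powFun p f x) := by
  obtain ⟨n, e, g, -, -, heg⟩ := Module.Finite.exists_comp_eq_id_of_projective R V
  refine ⟨∑ i : Fin n, (TensorProduct.mk R (Twist hR R) V).flip (e (Pi.single i 1)) ∘ₗ
    twistMap hR (powFun p (LinearMap.proj i ∘ₗ g) ∘ₗ (Inv p R V).subtype), fun f x => ?_⟩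
  have hf : f = ∑ i : Fin n, f (e (Pi.single i 1)) • (LinearMap.proj i ∘ₗ g) := by
    refine LinearMap.ext fun v => ?_
    have h1 : e (g v) = v := LinearMap.congr_fun heg v
    conv_lhs => rw [← h1, ← LinearMap.sum_single_apply (fun _ => R) (g v), map_sum, map_sum]
    rw [LinearMap.sum_apply]
    refine Finset.sum_congr rfl fun i _ => ?_
    have h2 : Pi.single i (g v i) = g v i • Pi.single (M := fun _ => R) i (1 : R) := by
      rw [← Pi.single_smul, smul_eq_mul, mul_one]
    change f (e (Pi.single i (g v i))) = _
    rw [h2, map_smul, map_smul]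
    simp [mul_comm]
  have hsum : ∀ s : Finset (Fin n),
      powFun p (∑ i ∈ s, f (e (Pi.single i 1)) • (LinearMap.proj i ∘ₗ g)) (x : ⨂[R]^p V) =
        ∑ i ∈ s, f (e (Pi.single i 1)) ^ p * powFun p (LinearMap.proj i ∘ₗ g) x := by
    intro s
    induction s using Finset.induction_on with
    | empty =>
      have := powFun_smul (p := p) (0 : R) (0 : V →ₗ[R] R) (x : ⨂[R]^p V)
      rw [zero_smul, zero_pow (Fact.out : p.Prime).ne_zero, zero_mul] at this
      simpa using this
    | insert i s his ih =>
      rw [Finset.sum_insert his, Finset.sum_insert his, powFun_add hR _ _ _ x.2, powFun_smul, ih]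
  conv_rhs => rw [hf, hsum]
  rw [LinearMap.sum_apply, map_sum, map_sum]
  exact Finset.sum_congr rfl fun i _ => twistFun_tmul hR f _ _

/-- The map `ψ̂ : (V^{⊗ p})^σ → V^{(1)}` for a finitely generated projective module `V`. It is the
transpose of the map `ψ` for the dual module `V^*`: for `x` invariant and `f ∈ V^*`, the pairing of
`ψ̂ x` with `1 ⊗ f ∈ (V^*)^{(1)}` equals the pairing of `x` with `ψ(1 ⊗ f) = [f ⊗ ⋯ ⊗ f]`. This
characterises `ψ̂ x`, since functionals of this form separate the points of `V^{(1)}`. -/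
noncomputable def psiHat (V : Type u) [AddCommGroup V] [Module R V] [Module.Finite R V]
    [Module.Projective R V] : Twist hR (Inv p R V) →ₗ[R] VTwist hR V :=
  Classical.choose (exists_psiHat hR V)

theorem twistFun_psiHat [Module.Finite R V] [Module.Projective R V] (f : V →ₗ[R] R)
    (x : Inv p R V) :
    twistFun hR f (psiHat hR V (toTwist hR _ x)) = toTwist hR R (powFun p f x) :=
  Classical.choose_spec (exists_psiHat hR V) f x

/-- Naturality of `ψ̂`. -/
theorem psiHat_invMap [Module.Finite R V] [Module.Projective R V] [Module.Finite R W]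
    [Module.Projective R W] (g : V →ₗ[R] W) (x : Twist hR (Inv p R V)) :
    psiHat hR W (twistMap hR (invMap p g) x) =
      LinearMap.lTensor (Twist hR R) g (psiHat hR V x) := by
  obtain ⟨x, rfl⟩ := (toTwist hR (Inv p R V)).surjective x
  refine twistFun_ext hR fun f => ?_
  have h1 : twistFun hR f (LinearMap.lTensor (Twist hR R) g (psiHat hR V (toTwist hR _ x))) =
      twistFun hR (f ∘ₗ g) (psiHat hR V (toTwist hR _ x)) := by
    rw [twistFun, twistFun, LinearMap.lTensor_comp]
    rfl
  have h2 : twistMap hR (invMap p g) (toTwist hR _ x) = toTwist hR _ (invMap p g x) := rfl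
  rw [h1, h2, twistFun_psiHat, twistFun_psiHat]
  exact congrArg (toTwist hR R) (powFun_powMap p f g x)

/-- The composite `ψ̂ ∘ tr` vanishes. -/
theorem psiHat_trace [Module.Finite R V] [Module.Projective R V] (x : Coinv p R V) :
    psiHat hR V (toTwist hR _ (trace p R V x)) = 0 := by
  refine twistFun_ext hR fun f => ?_
  rw [twistFun_psiHat, map_zero]
  obtain ⟨x, rfl⟩ := Submodule.Quotient.mk_surjective _ x
  have h : powFun p f (traceEnd p R V x) = 0 := by
    have hk : ∀ k : ℕ, powFun p f ((sigma p R V ^ k) x) = powFun p f x := by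
      intro k
      induction k with
      | zero => rfl
      | succ k ih => rw [pow_succ', Module.End.mul_apply, powFun_sigma, ih]
    rw [traceEnd, LinearMap.sum_apply, map_sum, Finset.sum_congr rfl fun k _ => hk k,
      Finset.sum_const, Finset.card_range, nsmul_eq_zero_of hR]
  exact congrArg (toTwist hR R) h

/-- The composite `tr ∘ ψ` vanishes. -/
theorem trace_psi (y : VTwist hR V) : twistMap hR (trace p R V) (psi hR V y) = 0 := by
  induction y using TensorProduct.induction_on with
  | zero => simp
  | add y z hy hz => rw [map_add, map_add, hy, hz, add_zero]
  | tmul r v =>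
    obtain ⟨r, rfl⟩ := (toTwist hR R).surjective r
    have hk : ∀ k : ℕ, (sigma p R V ^ k) (PiTensorProduct.tprod R fun _ => v) =
        PiTensorProduct.tprod R fun _ => v := by
      intro k
      induction k with
      | zero => rfl
      | succ k ih => rw [pow_succ', Module.End.mul_apply, ih, sigma_tprod]
    have h : traceEnd p R V (PiTensorProduct.tprod R fun _ => v) = 0 := by
      rw [traceEnd, LinearMap.sum_apply, Finset.sum_congr rfl fun k _ => hk k,
        Finset.sum_const, Finset.card_range, nsmul_eq_zero_of hR]
    have h' : trace p R V (powClass p R V v) = 0 := Subtype.ext h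
    have h'' : trace p R V (r • powClass p R V v) = 0 := by rw [map_smul, h', smul_zero]
    exact congrArg (toTwist hR _) h''

/-- Naturality of `ψ`. -/
theorem psi_lTensor (g : V →ₗ[R] W) (y : VTwist hR V) :
    psi hR W (LinearMap.lTensor (Twist hR R) g y) = twistMap hR (coinvMap p g) (psi hR V y) := by
  induction y using TensorProduct.induction_on with
  | zero => simp
  | add y z hy hz => simp only [map_add, hy, hz]
  | tmul r v =>
    obtain ⟨r, rfl⟩ := (toTwist hR R).surjective r
    have h : coinvMap p g (powClass p R V v) = powClass p R W (g v) :=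
      congrArg Submodule.Quotient.mk (PiTensorProduct.map_tprod (fun _ => g) (fun _ => v))
    have h' : r • powClass p R W (g v) = coinvMap p g (r • powClass p R V v) := by
      rw [map_smul, h]
    exact congrArg (toTwist hR _) h'

end Psi

/-! ### The cyclic-power extension -/

section CyclicExtension

variable {p : ℕ} [Fact p.Prime] {R : Type u} [CommRing R] (hR : (p : R) = 0)

instance (V : RProj R) : Module.Finite R V.obj := V.property.1

instance (V : RProj R) : Module.Projective R V.obj := V.property.2

/-- The degree `0` term of the pullback of `tr : (V^{⊗ p})_σ → (V^{⊗ p})^σ` along the Frobenius map: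
the fibre product of `ψ̂ : (V^{⊗ p})^σ → V^{(1)}` and `Fr : V → V^{(1)}`. -/
noncomputable abbrev fibre (V : RProj R) : Submodule R (Twist hR (Inv p R V.obj) × V.obj) :=
  LinearMap.ker ((psiHat hR V.obj) ∘ₗ LinearMap.fst R _ _ - frobMap hR V.obj ∘ₗ LinearMap.snd R _ _)

theorem mem_fibre {V : RProj R} {x : Twist hR (Inv p R V.obj) × V.obj} :
    x ∈ fibre hR V ↔ psiHat hR V.obj x.1 = frobMap hR V.obj x.2 :=
  sub_eq_zero

/-- Functoriality of the fibre product. -/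
noncomputable def fibreMap {V W : RProj R} (g : V.obj →ₗ[R] W.obj) : fibre hR V →ₗ[R] fibre hR W :=
  (LinearMap.prodMap (twistMap hR (invMap p g)) g).restrict (fun x hx => by
    rw [mem_fibre] at hx ⊢
    change psiHat hR W.obj (twistMap hR (invMap p g) x.1) = frobMap hR W.obj (g x.2)
    rw [psiHat_invMap, hx]
    rfl)

/-- The functor `C₁ : V ↦ (V^{⊗ p})_σ`, where `R` acts through the Frobenius map. -/
noncomputable def cyclicC₁ : RProj R ⥤ ModuleCat.{u} R where
  obj V := ModuleCat.of R (Twist hR (Coinv p R V.obj))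
  map g := ModuleCat.ofHom (twistMap hR (coinvMap p g.hom.hom))
  map_id V := by
    ext x
    obtain ⟨x, rfl⟩ := Submodule.Quotient.mk_surjective _ x
    exact congrArg Submodule.Quotient.mk (powMap_id p x)
  map_comp f g := by
    ext x
    obtain ⟨x, rfl⟩ := Submodule.Quotient.mk_surjective _ x
    exact congrArg Submodule.Quotient.mk (powMap_comp p g.hom.hom f.hom.hom x)

/-- The functor `C₀ : V ↦ (V^{⊗ p})^σ ×_{V^{(1)}} V`, where `R` acts on the first factor through the
Frobenius map. -/
noncomputable def cyclicC₀ : RProj R ⥤ ModuleCat.{u} R where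
  obj V := ModuleCat.of R (fibre hR V)
  map g := ModuleCat.ofHom (fibreMap hR g.hom.hom)
  map_id V := by
    refine ModuleCat.hom_ext (LinearMap.ext fun x => Subtype.ext (Prod.ext ?_ rfl))
    exact Subtype.ext (powMap_id p (x.1.1 : Inv p R V.obj).1)
  map_comp f g := by
    refine ModuleCat.hom_ext (LinearMap.ext fun x => Subtype.ext (Prod.ext ?_ rfl))
    exact Subtype.ext (powMap_comp p g.hom.hom f.hom.hom (x.1.1 : Inv p R _).1)

/-- The sequence `0 ⟶ I(R^{(1)}) --b--> C₁ --d--> C₀ --a--> I ⟶ 0` obtained by pulling back the trace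
complex `tr : (V^{⊗ p})_σ → (V^{⊗ p})^σ` along `Fr : V → V^{(1)}`: here `b` is `ψ`, `d` is
`x ↦ (tr x, 0)` and `a` is `(x, v) ↦ v`. -/
noncomputable def cyclicExtension : FourTerm R (Twist hR R) where
  C₁ := cyclicC₁ hR
  C₀ := cyclicC₀ hR
  b :=
    { app := fun V => ModuleCat.ofHom (psi hR V.obj)
      naturality := fun V W g => by
        ext : 1
        exact LinearMap.ext fun y => psi_lTensor hR g.hom.hom y }
  d :=
    { app := fun V => ModuleCat.ofHom
        (LinearMap.codRestrict (fibre hR V)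
          ((LinearMap.inl R _ _) ∘ₗ twistMap hR (trace p R V.obj))
          (fun x => by
            rw [mem_fibre]
            exact (psiHat_trace hR x).trans (map_zero (frobMap hR V.obj)).symm))
      naturality := fun V W g => by
        refine ModuleCat.hom_ext (LinearMap.ext fun x => Subtype.ext (Prod.ext ?_ ?_))
        · exact trace_coinvMap p g.hom.hom x
        · exact (map_zero g.hom.hom).symm }
  a :=
    { app := fun V => ModuleCat.ofHom (LinearMap.snd R _ _ ∘ₗ (fibre hR V).subtype)
      naturality := fun V W g => rfl }
  b_d := by
    ext V : 3
    exact LinearMap.ext fun y => Subtype.ext (Prod.ext (trace_psi hR y) rfl)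
  d_a := by
    ext V x
    rfl

end CyclicExtension

/-! ### Second Witt vectors -/

section Witt

variable {p : ℕ} [Fact p.Prime] {R : Type u} [CommRing R]

/-- The projection `W₂(R) → R`, `(x₀, x₁) ↦ x₀`. -/
noncomputable def wittProj (p : ℕ) [Fact p.Prime] (R : Type u) [CommRing R] :
    TruncatedWittVector p 2 R →+* R where
  toFun x := x.coeff 0
  map_one' := by
    rw [← map_one (WittVector.truncate 2), WittVector.coeff_truncate]
    exact WittVector.one_coeff_zero p R
  map_mul' x y := by
    obtain ⟨x, rfl⟩ := WittVector.truncate_surjective p 2 R x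
    obtain ⟨y, rfl⟩ := WittVector.truncate_surjective p 2 R y
    rw [← map_mul]
    simp only [WittVector.coeff_truncate]
    exact WittVector.mul_coeff_zero x y
  map_zero' := TruncatedWittVector.coeff_zero p 2 R 0
  map_add' x y := by
    obtain ⟨x, rfl⟩ := WittVector.truncate_surjective p 2 R x
    obtain ⟨y, rfl⟩ := WittVector.truncate_surjective p 2 R y
    rw [← map_add]
    simp only [WittVector.coeff_truncate]
    exact WittVector.add_coeff_zero x y

/-- The inclusion `R^{(1)} → W₂(R)`, `x ↦ (0, x)`. -/
noncomputable def wittIncl (hR : (p : R) = 0) : Twist hR R →+ TruncatedWittVector p 2 R where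
  toFun x := TruncatedWittVector.mk p ![0, (toTwist hR R).symm x]
  map_zero' := by
    ext i
    fin_cases i <;> simp
  map_add' x y := by
    have h : ∀ w : WittVector p R, TruncatedWittVector.mk p ![0, w.coeff 0] =
        WittVector.truncate 2 (WittVector.verschiebung w) := by
      intro w
      ext i
      rw [WittVector.coeff_truncate]
      fin_cases i
      · exact (WittVector.verschiebung_coeff_zero w).symm
      · exact (WittVector.verschiebung_coeff_succ w 0).symm
    have hx := h (WittVector.teichmuller p ((toTwist hR R).symm x))
    have hy := h (WittVector.teichmuller p ((toTwist hR R).symm y))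
    have hxy := h (WittVector.teichmuller p ((toTwist hR R).symm x) +
      WittVector.teichmuller p ((toTwist hR R).symm y))
    rw [map_add, map_add, ← hx, ← hy] at hxy
    simpa only [WittVector.add_coeff_zero, WittVector.teichmuller_coeff_zero, map_add] using hxy

end Witt

end CyclicPower

/-!
The trace complex `tr : (V^{⊗ p})_σ → (V^{⊗ p})^σ` is additive in `V` up to a canonical homotopy:
choosing one word from every nonconstant rotation orbit gives maps `c(f₁, …, fₙ)` from invariants to
coinvariants which measure the failure of `f ↦ f^{⊗ p}` to be additive. Three instances of this
cross effect prove the theorem. Applied to a dual-basis decomposition of the identity of `V`, it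
gives the exactness of the extension. Applied to two vectors of `V`, it gives a Witt-type addition
on `V × (V^{⊗ p})_σ`, which is a splitting over abelian groups. Applied to the multiplications by
`r` and `s` on `V`, it shows that in the ring of regular endomorphisms of any splitting the
multiplicative section `r ↦ C₀₁(r)` fails to be additive by the image of
`((r + s)^p - r^p - s^p) / p`. The Teichmüller section of `W₂(R)` has the same additive
defect, and a square-zero extension with a multiplicative section is determined by that defect.
-/

namespace CyclicPower

universe u v w

/-! ### Orbit weights -/

section OrbitWeight

variable {p : ℕ} {A M : Type*} [AddCommGroup M]

/-- The rotation of words of length `p` by `k` places. -/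
@[simps apply]
def rotateWord [NeZero p] (k : Fin p) : (Fin p → A) ≃ (Fin p → A) where
  toFun w i := w (i + k)
  invFun w i := w (i - k)
  left_inv w := by simp
  right_inv w := by simp

theorem rotateWord_mem_range_const_iff [NeZero p] {k : Fin p} {w : Fin p → A} :
    rotateWord k w ∈ Set.range (Function.const (Fin p)) ↔
      w ∈ Set.range (Function.const (Fin p)) := by
  refine ⟨fun ⟨a, ha⟩ => ⟨a, ?_⟩, fun ⟨a, ha⟩ => ⟨a, by rw [← ha]; rfl⟩⟩
  rw [← (rotateWord k).apply_eq_iff_eq, ← ha]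
  rfl

theorem sum_rotateWord_symm [NeZero p] (F : Equiv.Perm (Fin p → A) → M) :
    ∑ k, F (rotateWord k).symm = ∑ k, F (rotateWord k) := by
  rw [← Equiv.sum_comp (Equiv.neg (Fin p))]
  refine Finset.sum_congr rfl fun k _ => congrArg F (Equiv.ext fun w => ?_)
  simp only [rotateWord, Equiv.neg_apply, Equiv.coe_fn_symm_mk, sub_neg_eq_add, Equiv.coe_fn_mk]

/-- An integral weight on words of length `p` is an orbit weight if it vanishes on constant words
and its values on the rotations of any other word add up to `1`. -/
structure IsOrbitWeight [NeZero p] (W : (Fin p → A) → ℤ) : Prop where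
  apply_const : ∀ a, W (Function.const _ a) = 0
  sum_rotateWord : ∀ w ∉ Set.range (Function.const (Fin p)), ∑ k, W (rotateWord k w) = 1

section

variable [NeZero p] {U W : (Fin p → A) → ℤ}

theorem IsOrbitWeight.mul_sum_rotateWord (hU : IsOrbitWeight U) (hW : IsOrbitWeight W)
    (w : Fin p → A) : U w * ∑ k, W (rotateWord k w) = U w := by
  by_cases hw : w ∈ Set.range (Function.const (Fin p))
  · obtain ⟨a, rfl⟩ := hw
    rw [hU.apply_const, zero_mul]
  · rw [hW.sum_rotateWord w hw, mul_one]

theorem sum_sum_rotateWord_symm_smul [Fintype A] (W : (Fin p → A) → ℤ) (F : (Fin p → A) → M) :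
    ∑ k, ∑ w, W w • F ((rotateWord k).symm w) = ∑ w, (∑ k, W (rotateWord k w)) • F w := by
  simp only [Finset.sum_smul]
  rw [Finset.sum_comm (s := (Finset.univ : Finset (Fin p → A)))]
  refine Finset.sum_congr rfl fun k _ => ?_
  rw [← (rotateWord k).sum_comp]
  simp only [Equiv.symm_apply_apply]

theorem sum_range_const [Fintype A]
    [DecidablePred (· ∈ Set.range (Function.const (Fin p) : A → Fin p → A))]
    (F : (Fin p → A) → M) :
    (∑ w, if w ∈ Set.range (Function.const (Fin p)) then F w else 0) =
      ∑ a, F (Function.const _ a) := by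
  classical
  rw [← Finset.sum_filter, ← Finset.sum_image (f := F)
    fun a _ b _ h => Function.const_injective h]
  congr 1
  ext w
  simp

theorem IsOrbitWeight.sum_sum_rotateWord_symm_smul [Fintype A] (hW : IsOrbitWeight W)
    (F : (Fin p → A) → M) :
    ∑ k, ∑ w, W w • F ((rotateWord k).symm w) = ∑ w, F w - ∑ a, F (Function.const _ a) := by
  classical
  rw [CyclicPower.sum_sum_rotateWord_symm_smul, ← sum_range_const, eq_sub_iff_add_eq,
    ← Finset.sum_add_distrib]
  refine Finset.sum_congr rfl fun w _ => ?_
  split_ifs with hw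
  · obtain ⟨a, rfl⟩ := hw
    have hconst (k : Fin p) : rotateWord k (Function.const _ a) = Function.const _ a := rfl
    simp only [hconst, hW.apply_const, Finset.sum_const_zero, zero_smul, zero_add]
  · rw [hW.sum_rotateWord w hw, one_smul, add_zero]

/-- Double counting of the pairs consisting of a word and one of its rotations. -/
theorem IsOrbitWeight.sum_smul_eq [Fintype A] (hU : IsOrbitWeight U) (hW : IsOrbitWeight W)
    {F : (Fin p → A) → M} (hF : ∀ k w, F (rotateWord k w) = F w) :
    ∑ w, U w • F w = ∑ w, W w • F w := by
  have hF' (k : Fin p) (w : Fin p → A) : F ((rotateWord k).symm w) = F w := by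
    rw [← hF k, Equiv.apply_symm_apply]
  calc ∑ w, U w • F w = ∑ w, (∑ k, W (rotateWord k w)) • U w • F w := by
        simp only [smul_smul, mul_comm _ (U _), hU.mul_sum_rotateWord hW]
    _ = ∑ k, ∑ w, W w • U ((rotateWord k).symm w) • F ((rotateWord k).symm w) :=
        (CyclicPower.sum_sum_rotateWord_symm_smul W fun w => U w • F w).symm
    _ = ∑ w, (∑ k, U ((rotateWord k).symm w)) • W w • F w := by
        simp only [hF', Finset.sum_smul, smul_comm (W _)]
        exact Finset.sum_comm
    _ = ∑ w, (∑ k, U (rotateWord k w)) • W w • F w := by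
        refine Finset.sum_congr rfl fun w _ => ?_
        rw [sum_rotateWord_symm fun e => U (e w)]
    _ = ∑ w, W w • F w := by
        simp only [smul_smul, mul_comm _ (W _), hW.mul_sum_rotateWord hU]

theorem IsOrbitWeight.ite_comp {B : Type*} {U : (Fin p → B) → ℤ} (hU : IsOrbitWeight U)
    (hW : IsOrbitWeight W) (π : A → B)
    [DecidablePred fun w : Fin p → A => π ∘ w ∈ Set.range (Function.const (Fin p))] :
    IsOrbitWeight fun w : Fin p → A =>
      if π ∘ w ∈ Set.range (Function.const (Fin p)) then W w else U (π ∘ w) where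
  apply_const a := by
    rw [if_pos ⟨π a, rfl⟩, hW.apply_const]
  sum_rotateWord w hw := by
    have hcomp (k : Fin p) : π ∘ rotateWord k w = rotateWord k (π ∘ w) := rfl
    simp only [hcomp, rotateWord_mem_range_const_iff]
    split_ifs with h
    · exact hW.sum_rotateWord w hw
    · exact hU.sum_rotateWord _ h

theorem IsOrbitWeight.comp_injective {B : Type*} (hW : IsOrbitWeight W) {ι : B → A}
    (hι : Function.Injective ι) : IsOrbitWeight fun w : Fin p → B => W (ι ∘ w) where
  apply_const b := hW.apply_const (ι b)
  sum_rotateWord w hw := by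
    refine hW.sum_rotateWord (ι ∘ w) fun ⟨a, ha⟩ => hw ⟨w 0, funext fun i => hι ?_⟩
    exact (congrFun ha 0).symm.trans (congrFun ha i)

end

variable [Fact p.Prime]

theorem rotateWord_injective {w : Fin p → A} (hw : w ∉ Set.range (Function.const (Fin p))) :
    Function.Injective fun k => rotateWord k w := by
  intro k l hkl
  let stabilizer : AddSubgroup (Fin p) :=
    { carrier := {m | ∀ i, w (i + m) = w i}
      zero_mem' := fun i => by rw [add_zero]
      add_mem' := fun {m n} hm hn i => by rw [← add_assoc, hn, hm]
      neg_mem' := fun {m} hm i => by rw [← hm, neg_add_cancel_right] }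
  have hmem : k - l ∈ stabilizer := fun i => by
    have h := congrFun hkl (i - l)
    simp only [rotateWord_apply, sub_add_cancel] at h
    rw [← h]
    congr 1
    abel
  have : Fact (Nat.card (Fin p)).Prime := ⟨by rw [Nat.card_fin]; exact Fact.out⟩
  rcases stabilizer.eq_bot_or_eq_top_of_prime_card with h | h
  · rw [h, AddSubgroup.mem_bot] at hmem
    exact sub_eq_zero.1 hmem
  · refine absurd ⟨w 0, funext fun i => ?_⟩ hw
    have hi : i ∈ stabilizer := h ▸ AddSubgroup.mem_top i
    rw [Function.const_apply, ← hi 0, zero_add]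

/-- Two words are equivalent if one is a rotation of the other. -/
def rotationSetoid [NeZero p] (A : Type*) : Setoid (Fin p → A) where
  r w w' := ∃ k, rotateWord k w = w'
  iseqv :=
    { refl := fun w => ⟨0, by ext; simp⟩
      symm := by
        rintro w _ ⟨k, rfl⟩
        exact ⟨-k, by ext; simp⟩
      trans := by
        rintro w _ _ ⟨k, rfl⟩ ⟨l, rfl⟩
        exact ⟨l + k, by ext; simp [add_assoc]⟩ }

open Classical in
/-- The orbit weight given by the indicator function of a set of representatives of the rotation
classes of nonconstant words. -/
noncomputable def orbitWeight (w : Fin p → A) : ℤ :=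
  if w ∉ Set.range (Function.const (Fin p)) ∧ (Quotient.mk (rotationSetoid A) w).out = w then 1
  else 0

theorem isOrbitWeight_orbitWeight : IsOrbitWeight (orbitWeight : (Fin p → A) → ℤ) where
  apply_const a := if_neg fun h => h.1 ⟨a, rfl⟩
  sum_rotateWord w hw := by
    classical
    have hmk (k : Fin p) : Quotient.mk (rotationSetoid A) (rotateWord k w) = Quotient.mk _ w :=
      (Quotient.sound (s := rotationSetoid A) ⟨k, rfl⟩).symm
    obtain ⟨l, hl⟩ : ∃ l, rotateWord l w = (Quotient.mk (rotationSetoid A) w).out :=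
      (rotationSetoid A).symm (Quotient.mk_out w)
    have hind (k : Fin p) : orbitWeight (rotateWord k w) = if l = k then 1 else 0 := by
      rw [orbitWeight, hmk, ← hl, rotateWord_mem_range_const_iff]
      exact if_congr ⟨fun h => rotateWord_injective hw h.2, fun h => ⟨hw, by rw [h]⟩⟩ rfl rfl
    simp [hind]

/-- The sum of the values of a function at one representative of each rotation class of nonconstant
words. -/
noncomputable def orbitSum [Fintype A] (F : (Fin p → A) → M) : M :=
  ∑ w, orbitWeight w • F w

theorem IsOrbitWeight.sum_smul_eq_orbitSum [Fintype A] {W : (Fin p → A) → ℤ}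
    (hW : IsOrbitWeight W) {F : (Fin p → A) → M} (hF : ∀ k w, F (rotateWord k w) = F w) :
    ∑ w, W w • F w = orbitSum F :=
  hW.sum_smul_eq isOrbitWeight_orbitWeight hF

theorem sum_orbitSum_rotateWord_symm [Fintype A] (F : (Fin p → A) → M) :
    ∑ k, orbitSum (fun w => F ((rotateWord k).symm w)) =
      ∑ w, F w - ∑ a, F (Function.const _ a) :=
  isOrbitWeight_orbitWeight.sum_sum_rotateWord_symm_smul F

theorem orbitSum_comp_injective [Fintype A] {B : Type*} [Fintype B] {ι : B → A}
    (hι : Function.Injective ι) {F : (Fin p → A) → M} (hF : ∀ k w, F (rotateWord k w) = F w)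
    (hF₀ : ∀ w ∉ Set.range fun u : Fin p → B => ι ∘ u, F w = 0) :
    orbitSum (fun w => F (ι ∘ w)) = orbitSum F := by
  rw [← (isOrbitWeight_orbitWeight.comp_injective hι).sum_smul_eq_orbitSum
    (F := fun w => F (ι ∘ w)) fun k w => hF k (ι ∘ w)]
  refine Fintype.sum_of_injective (ι ∘ ·) hι.comp_left _ _ (fun w hw => ?_) fun w => rfl
  rw [hF₀ w hw, smul_zero]

/-- Both sides are given by orbit weights on words in `A`, and the orbit weight does not matter. -/
theorem orbitSum_eq_add_sum_fiber [Fintype A] {B : Type*} [Fintype B] [DecidableEq B] (π : A → B)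
    {F : (Fin p → A) → M} (hF : ∀ k w, F (rotateWord k w) = F w) :
    orbitSum F = orbitSum (fun u : Fin p → B => ∑ w : Fin p → A with π ∘ w = u, F w) +
      ∑ b, orbitSum fun w => if π ∘ w = Function.const _ b then F w else 0 := by
  classical
  have hbase : orbitSum (fun u : Fin p → B => ∑ w : Fin p → A with π ∘ w = u, F w) =
      ∑ w, orbitWeight (π ∘ w) • F w := by
    rw [orbitSum, ← Finset.sum_fiberwise _ (π ∘ ·)]
    refine Finset.sum_congr rfl fun u _ => ?_
    rw [Finset.smul_sum]
    refine Finset.sum_congr rfl fun w hw => ?_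
    rw [(Finset.mem_filter.1 hw).2]
  have hW := isOrbitWeight_orbitWeight.ite_comp (isOrbitWeight_orbitWeight (p := p)) π
  rw [← hW.sum_smul_eq_orbitSum hF, hbase]
  simp only [orbitSum]
  rw [Finset.sum_comm, ← Finset.sum_add_distrib]
  refine Finset.sum_congr rfl fun w _ => ?_
  split_ifs with hw
  · obtain ⟨b, hb⟩ := hw
    simp only [← hb, Function.const_inj, isOrbitWeight_orbitWeight.apply_const, zero_smul,
      zero_add, smul_ite, smul_zero, Finset.sum_ite_eq, Finset.mem_univ, if_true]
  · rw [Finset.sum_eq_zero fun b _ => ?_, add_zero]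
    rw [if_neg fun h => hw ⟨b, h.symm⟩, smul_zero]

theorem map_orbitSum [Fintype A] {N G : Type*} [AddCommGroup N] [FunLike G M N]
    [AddMonoidHomClass G M N] (f : G) (F : (Fin p → A) → M) :
    f (orbitSum F) = orbitSum fun w => f (F w) := by
  simp only [orbitSum, map_sum, map_zsmul]

theorem orbitSum_sum [Fintype A] {I : Type*} (s : Finset I) (F : I → (Fin p → A) → M) :
    orbitSum (fun w => ∑ k ∈ s, F k w) = ∑ k ∈ s, orbitSum (F k) := by
  simp only [orbitSum, Finset.smul_sum]
  exact Finset.sum_comm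

theorem orbitSum_eq_zero [Fintype A] {F : (Fin p → A) → M}
    (hF : ∀ w ∉ Set.range (Function.const (Fin p)), F w = 0) : orbitSum F = 0 := by
  refine Finset.sum_eq_zero fun w _ => ?_
  by_cases hw : w ∈ Set.range (Function.const (Fin p))
  · obtain ⟨a, rfl⟩ := hw
    rw [isOrbitWeight_orbitWeight.apply_const, zero_smul]
  · rw [hF w hw, smul_zero]

end OrbitWeight

section PowDefect

variable {p : ℕ} [Fact p.Prime] {R : Type*} [CommRing R] {A : Type*} [Fintype A]

variable (p) in
/-- The integral polynomial `((∑ a, c a) ^ p - ∑ a, c a ^ p) / p` in the family `c`, as a sum over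
rotation classes of nonconstant words. -/
noncomputable def powDefect (c : A → R) : R :=
  orbitSum fun w : Fin p → A => ∏ i, c (w i)

theorem natCast_mul_powDefect (c : A → R) :
    p * powDefect p c = (∑ a, c a) ^ p - ∑ a, c a ^ p := by
  let F (w : Fin p → A) : R := ∏ i, c (w i)
  have hF (k : Fin p) (w : Fin p → A) : F ((rotateWord k).symm w) = F w :=
    (Equiv.subRight k).prod_comp fun i => c (w i)
  have h := sum_orbitSum_rotateWord_symm F
  simp only [hF, Finset.sum_const, Finset.card_univ, Fintype.card_fin, nsmul_eq_mul] at h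
  refine h.trans (congrArg₂ _ ?_ (Finset.sum_congr rfl fun a _ => ?_))
  · rw [← Fintype.prod_sum, Finset.prod_const, Finset.card_univ, Fintype.card_fin]
  · simp [F]

theorem map_powDefect {S : Type*} [CommRing S] (f : R →+* S) (c : A → R) :
    f (powDefect p c) = powDefect p fun a => f (c a) := by
  simp only [powDefect, map_orbitSum, map_prod]

end PowDefect

/-! ### The cross effect of the trace complex -/

section Rotation

variable {p : ℕ} {R : Type u} [CommRing R]
  {V W : Type u} [AddCommGroup V] [Module R V] [AddCommGroup W] [Module R W]

theorem coinv_mk_sigma (x : ⨂[R]^p V) :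
    (Submodule.Quotient.mk (sigma p R V x) : Coinv p R V) = Submodule.Quotient.mk x :=
  ((Submodule.Quotient.eq _).2 (LinearMap.mem_range.2 ⟨x, rfl⟩)).symm

theorem coinv_mk_sigma_pow (n : ℕ) (x : ⨂[R]^p V) :
    (Submodule.Quotient.mk ((sigma p R V ^ n) x) : Coinv p R V) = Submodule.Quotient.mk x := by
  induction n with
  | zero => rfl
  | succ n ih => rw [pow_succ', Module.End.mul_apply, coinv_mk_sigma, ih]

theorem sigma_inv (x : Inv p R V) : sigma p R V x = x :=
  (sub_eq_zero.1 (LinearMap.mem_ker.1 x.property)).symm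

theorem sigma_pow_inv (n : ℕ) (x : Inv p R V) : (sigma p R V ^ n) x = x := by
  induction n with
  | zero => rfl
  | succ n ih => rw [pow_succ', Module.End.mul_apply, ih, sigma_inv]

theorem traceEnd_apply (x : ⨂[R]^p V) :
    traceEnd p R V x = ∑ k : Fin p, (sigma p R V ^ (k : ℕ)) x := by
  rw [traceEnd, LinearMap.sum_apply, Finset.sum_range fun k => (sigma p R V ^ k) x]

theorem coe_trace_mk (x : ⨂[R]^p V) :
    (trace p R V (Submodule.Quotient.mk x) : ⨂[R]^p V) = traceEnd p R V x := rfl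

theorem mk_trace (hR : (p : R) = 0) (c : Coinv p R V) :
    (Submodule.Quotient.mk (trace p R V c : ⨂[R]^p V) : Coinv p R V) = 0 := by
  obtain ⟨x, rfl⟩ := Submodule.Quotient.mk_surjective _ c
  rw [coe_trace_mk, traceEnd_apply, ← Submodule.mkQ_apply, map_sum]
  simp only [Submodule.mkQ_apply, coinv_mk_sigma_pow, Finset.sum_const, Finset.card_univ,
    Fintype.card_fin]
  rw [← Nat.cast_smul_eq_nsmul R, hR, zero_smul]

theorem sigma_pow_tprod [NeZero p] (k : Fin p) (v : Fin p → V) :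
    (sigma p R V ^ (k : ℕ)) (PiTensorProduct.tprod R v) =
      PiTensorProduct.tprod R ((rotateWord k).symm v) := by
  have h (n : ℕ) (v : Fin p → V) : (sigma p R V ^ n) (PiTensorProduct.tprod R v) =
      PiTensorProduct.tprod R fun i => v (i - Fin.ofNat p n) := by
    induction n with
    | zero => simp
    | succ n ih =>
      have hpred (i : Fin p) : (finRotate p).symm i = i - 1 := by
        rw [Equiv.symm_apply_eq, finRotate_apply, sub_add_cancel]
      have hsucc : Fin.ofNat p (n + 1) = Fin.ofNat p n + 1 := by
        ext
        simp [Fin.val_add]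
      rw [pow_succ', Module.End.mul_apply, ih, sigma_tprod]
      simp only [hpred, hsucc, sub_sub, add_comm]
  rw [h, Fin.ofNat_val_eq_self]
  rfl

theorem sigma_pow_map [NeZero p] (k : Fin p) (g : Fin p → V →ₗ[R] W) (x : ⨂[R]^p V) :
    (sigma p R W ^ (k : ℕ)) (PiTensorProduct.map g x) =
      PiTensorProduct.map ((rotateWord k).symm g) ((sigma p R V ^ (k : ℕ)) x) := by
  suffices (sigma p R W ^ (k : ℕ)) ∘ₗ PiTensorProduct.map g =
      PiTensorProduct.map ((rotateWord k).symm g) ∘ₗ (sigma p R V ^ (k : ℕ)) from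
    LinearMap.congr_fun this x
  refine PiTensorProduct.ext (MultilinearMap.ext fun v => ?_)
  simp only [LinearMap.compMultilinearMap_apply, LinearMap.comp_apply, PiTensorProduct.map_tprod,
    sigma_pow_tprod]
  rfl

theorem mk_map_rotateWord [NeZero p] {A : Type*} (g : A → V →ₗ[R] W)
    (x : Inv p R V) (k : Fin p) (w : Fin p → A) :
    (Submodule.Quotient.mk (PiTensorProduct.map (g ∘ rotateWord k w) (x : ⨂[R]^p V)) :
      Coinv p R W) = Submodule.Quotient.mk (PiTensorProduct.map (g ∘ w) (x : ⨂[R]^p V)) := by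
  rw [← coinv_mk_sigma_pow (k : ℕ), sigma_pow_map, sigma_pow_inv]
  congr 3
  exact (rotateWord k).symm_apply_apply (g ∘ w)

theorem powMap_sum {A : Type*} [Fintype A] (g : A → V →ₗ[R] W) (x : ⨂[R]^p V) :
    powMap p (∑ a, g a) x = ∑ w : Fin p → A, PiTensorProduct.map (g ∘ w) x := by
  classical
  have h := (PiTensorProduct.mapMultilinear R (fun _ : Fin p => V) fun _ => W).map_sum
    fun (_ : Fin p) a => g a
  simp only [PiTensorProduct.mapMultilinear_apply] at h
  rw [powMap, h, LinearMap.sum_apply]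
  rfl

theorem map_fiberwise_sum {A B : Type*} [Fintype A] [DecidableEq B] (π : A → B) (g : A → V →ₗ[R] W)
    (w : Fin p → B) (x : ⨂[R]^p V) :
    PiTensorProduct.map (fun i => ∑ a with π a = w i, g a) x =
      ∑ u : Fin p → A with π ∘ u = w, PiTensorProduct.map (g ∘ u) x := by
  classical
  have h := (PiTensorProduct.mapMultilinear R (fun _ : Fin p => V) fun _ => W).map_sum_finset
    (fun _ a => g a) fun i => {a | π a = w i}
  simp only [PiTensorProduct.mapMultilinear_apply] at h
  rw [h, LinearMap.sum_apply]
  refine Finset.sum_congr (Finset.ext fun u => ?_) fun u _ => rfl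
  simp only [Fintype.mem_piFinset, Finset.mem_filter_univ, funext_iff, Function.comp_apply]

theorem mk_map_eq_zero {g : Fin p → V →ₗ[R] W} {i : Fin p} (hi : g i = 0) (x : ⨂[R]^p V) :
    (Submodule.Quotient.mk (PiTensorProduct.map g x) : Coinv p R W) = 0 := by
  rw [← PiTensorProduct.mapMultilinear_apply, MultilinearMap.map_coord_zero _ i hi,
    LinearMap.zero_apply, Submodule.Quotient.mk_zero]

theorem coe_invMap (g : V →ₗ[R] W) (x : Inv p R V) :
    (invMap p g x : ⨂[R]^p W) = powMap p g x := rfl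

theorem coinvMap_mk (g : V →ₗ[R] W) (x : ⨂[R]^p V) :
    coinvMap p g (Submodule.Quotient.mk x) = Submodule.Quotient.mk (powMap p g x) := rfl

variable (p R) in
/-- The invariant element `v ⊗ ⋯ ⊗ v`. -/
noncomputable def powInv (v : V) : Inv p R V :=
  ⟨PiTensorProduct.tprod R fun _ => v, by
    change PiTensorProduct.tprod R (fun _ => v) - sigma p R V _ = 0
    rw [sigma_tprod, sub_self]⟩

theorem powFun_powInv (f : V →ₗ[R] R) (v : V) : powFun p f (powInv p R v) = f v ^ p := by
  refine (powFun_tprod p f _).trans ?_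
  rw [Finset.prod_const, Finset.card_univ, Fintype.card_fin]

theorem invMap_powInv (g : V →ₗ[R] W) (v : V) : invMap p g (powInv p R v) = powInv p R (g v) :=
  Subtype.ext (PiTensorProduct.map_tprod _ _)

end Rotation

section CrossEffect

variable {p : ℕ} [Fact p.Prime] {R : Type u} [CommRing R]
  {V W X : Type u} [AddCommGroup V] [Module R V] [AddCommGroup W] [Module R W]
  [AddCommGroup X] [Module R X] {A B : Type*} [Fintype A] [Fintype B]

/-- The canonical homotopy which measures the failure of the trace complex
`tr : (V^{⊗ p})_σ → (V^{⊗ p})^σ` to be additive on the family `g` of linear maps: the sum of the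
maps `[g (w 1) ⊗ ⋯ ⊗ g (w p)]` over representatives of the rotation classes of nonconstant
words `w`. -/
noncomputable def crossEffect (g : A → V →ₗ[R] W) : Inv p R V →ₗ[R] Coinv p R W :=
  orbitSum fun w : Fin p → A =>
    (LinearMap.range (oneSubSigma p R W)).mkQ ∘ₗ PiTensorProduct.map (g ∘ w) ∘ₗ
      (Inv p R V).subtype

theorem crossEffect_apply (g : A → V →ₗ[R] W) (x : Inv p R V) :
    crossEffect g x = orbitSum fun w : Fin p → A =>
      (Submodule.Quotient.mk (PiTensorProduct.map (g ∘ w) (x : ⨂[R]^p V)) : Coinv p R W) :=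
  map_orbitSum (LinearMap.applyₗ x) _

theorem trace_crossEffect (g : A → V →ₗ[R] W) (x : Inv p R V) :
    trace p R W (crossEffect g x) = invMap p (∑ a, g a) x - ∑ a, invMap p (g a) x := by
  have hterm (w : Fin p → A) :
      traceEnd p R W (PiTensorProduct.map (g ∘ w) (x : ⨂[R]^p V)) =
        ∑ k, PiTensorProduct.map (g ∘ (rotateWord k).symm w) (x : ⨂[R]^p V) := by
    rw [traceEnd_apply]
    refine Finset.sum_congr rfl fun k _ => ?_
    rw [sigma_pow_map, sigma_pow_inv]
    rfl
  refine Subtype.ext ?_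
  rw [crossEffect_apply, map_orbitSum, ← Submodule.subtype_apply, map_orbitSum]
  simp only [Submodule.subtype_apply, coe_trace_mk, hterm]
  calc orbitSum (fun w => ∑ k, PiTensorProduct.map (g ∘ (rotateWord k).symm w) (x : ⨂[R]^p V))
      = ∑ k, orbitSum fun w =>
          PiTensorProduct.map (g ∘ (rotateWord k).symm w) (x : ⨂[R]^p V) := by
        rw [orbitSum_sum]
    _ = _ := by
        rw [sum_orbitSum_rotateWord_symm fun w => PiTensorProduct.map (g ∘ w) (x : ⨂[R]^p V),
          ← powMap_sum, AddSubgroupClass.coe_sub, coe_invMap, AddSubmonoidClass.coe_finsetSum]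
        rfl

theorem crossEffect_trace (g : A → V →ₗ[R] W) (x : Coinv p R V) :
    crossEffect g (trace p R V x) = coinvMap p (∑ a, g a) x - ∑ a, coinvMap p (g a) x := by
  obtain ⟨x, rfl⟩ := Submodule.Quotient.mk_surjective _ x
  have hterm (k : Fin p) (w : Fin p → A) :
      (Submodule.Quotient.mk (PiTensorProduct.map (g ∘ w) ((sigma p R V ^ (k : ℕ)) x)) :
        Coinv p R W) =
      Submodule.Quotient.mk (PiTensorProduct.map (g ∘ rotateWord k w) x) := by
    rw [← coinv_mk_sigma_pow (k : ℕ) (PiTensorProduct.map (g ∘ rotateWord k w) x), sigma_pow_map]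
    congr 3
    exact ((rotateWord k).symm_apply_apply (g ∘ w)).symm
  let F (w : Fin p → A) : Coinv p R W := Submodule.Quotient.mk (PiTensorProduct.map (g ∘ w) x)
  calc crossEffect g (trace p R V (Submodule.Quotient.mk x))
      = ∑ k, orbitSum fun w => F (rotateWord k w) := by
        rw [crossEffect_apply, coe_trace_mk, traceEnd_apply]
        simp only [← Submodule.mkQ_apply, map_sum]
        simp only [Submodule.mkQ_apply, hterm, orbitSum_sum, F]
    _ = ∑ w, F w - ∑ a, F (Function.const _ a) := by
        rw [← sum_rotateWord_symm fun e => orbitSum fun w => F (e w),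
          sum_orbitSum_rotateWord_symm]
    _ = _ := by
        rw [coinvMap_mk, powMap_sum, ← Submodule.mkQ_apply, map_sum]
        rfl

theorem coinvMap_crossEffect (h : W →ₗ[R] X) (g : A → V →ₗ[R] W) (x : Inv p R V) :
    coinvMap p h (crossEffect g x) = crossEffect (fun a => h ∘ₗ g a) x := by
  rw [crossEffect_apply, map_orbitSum, crossEffect_apply]
  refine congrArg orbitSum (funext fun w => congrArg Submodule.Quotient.mk ?_)
  exact (LinearMap.congr_fun (PiTensorProduct.map_comp (fun _ => h) (g ∘ w)) x).symm

theorem crossEffect_comp_injective {ι : B → A} (hι : Function.Injective ι) {g : A → V →ₗ[R] W}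
    (hg : ∀ a ∉ Set.range ι, g a = 0) (x : Inv p R V) :
    crossEffect (g ∘ ι) x = crossEffect g x := by
  rw [crossEffect_apply, crossEffect_apply]
  let F (w : Fin p → A) : Coinv p R W :=
    Submodule.Quotient.mk (PiTensorProduct.map (g ∘ w) (x : ⨂[R]^p V))
  refine orbitSum_comp_injective (F := F) hι (mk_map_rotateWord g x) fun w hw => ?_
  obtain ⟨i, hi⟩ : ∃ i, w i ∉ Set.range ι := by
    by_contra! h
    choose u hu using h
    exact hw ⟨u, funext hu⟩
  exact mk_map_eq_zero (g := g ∘ w) (hg (w i) hi) _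

theorem crossEffect_eq_zero {g : A → V →ₗ[R] W} {a : A} (hg : ∀ b ≠ a, g b = 0)
    (x : Inv p R V) : crossEffect g x = 0 := by
  rw [crossEffect_apply]
  refine orbitSum_eq_zero fun w hw => ?_
  obtain ⟨i, hi⟩ : ∃ i, w i ≠ a := by
    by_contra! h
    exact hw ⟨a, (funext h).symm⟩
  exact mk_map_eq_zero (g := g ∘ w) (hg (w i) hi) _

theorem crossEffect_eq_add_sum_fiber [DecidableEq B] (π : A → B) (g : A → V →ₗ[R] W)
    (x : Inv p R V) :
    crossEffect g x = crossEffect (fun b => ∑ a with π a = b, g a) x +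
      ∑ b, crossEffect (fun a => if π a = b then g a else 0) x := by
  classical
  let F (w : Fin p → A) : Coinv p R W :=
    Submodule.Quotient.mk (PiTensorProduct.map (g ∘ w) (x : ⨂[R]^p V))
  rw [crossEffect_apply, orbitSum_eq_add_sum_fiber (F := F) π (mk_map_rotateWord g x)]
  congr 1
  · rw [crossEffect_apply]
    refine congrArg orbitSum (funext fun w => ?_)
    rw [show (fun b => ∑ a with π a = b, g a) ∘ w = fun i => ∑ a with π a = w i, g a from rfl,
      map_fiberwise_sum, ← Submodule.mkQ_apply, map_sum]
    rfl
  · refine Finset.sum_congr rfl fun b _ => ?_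
    rw [crossEffect_apply]
    refine congrArg orbitSum (funext fun w => ?_)
    let g' (a : A) : V →ₗ[R] W := if π a = b then g a else 0
    by_cases hw : π ∘ w = Function.const _ b
    · have hg' : g' ∘ w = g ∘ w := funext fun i => if_pos (congrFun hw i)
      rw [if_pos hw]
      change _ = Submodule.Quotient.mk (PiTensorProduct.map (g' ∘ w) _)
      rw [hg']
    · rw [if_neg hw]
      obtain ⟨i, hi⟩ : ∃ i, π (w i) ≠ b := by
        by_contra! h
        exact hw (funext h)
      exact (mk_map_eq_zero (g := g' ∘ w) (if_neg hi) _).symm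

theorem crossEffect_smul_id (c : A → R) (x : Inv p R V) :
    crossEffect (fun a => c a • (LinearMap.id : V →ₗ[R] V)) x =
      powDefect p c • Submodule.Quotient.mk (x : ⨂[R]^p V) := by
  have hmap (w : Fin p → A) :
      (Submodule.Quotient.mk (PiTensorProduct.map
        ((fun a => c a • (LinearMap.id : V →ₗ[R] V)) ∘ w) (x : ⨂[R]^p V)) : Coinv p R V) =
      (∏ i, c (w i)) • Submodule.Quotient.mk (x : ⨂[R]^p V) := by
    rw [← Submodule.Quotient.mk_smul, ← PiTensorProduct.mapMultilinear_apply]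
    refine congrArg Submodule.Quotient.mk ?_
    have h := (PiTensorProduct.mapMultilinear R (fun _ : Fin p => V) fun _ => V).map_smul_univ
      (fun i => c (w i)) fun _ => LinearMap.id
    rw [PiTensorProduct.mapMultilinear_apply _ _ _ (fun _ => LinearMap.id),
      PiTensorProduct.map_id] at h
    exact LinearMap.congr_fun h x
  rw [crossEffect_apply]
  simp only [hmap]
  exact (map_orbitSum ((LinearMap.lsmul R (Coinv p R V)).flip
    (Submodule.Quotient.mk (x : ⨂[R]^p V))) _).symm

end CrossEffect

/-! ### Exactness of the cyclic-power extension -/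

section RankOne

variable {p : ℕ} {R : Type u} [CommRing R] {V W : Type u} [AddCommGroup V] [Module R V]
  [AddCommGroup W] [Module R W]

/-- The functional on `(V^{⊗ p})_σ` induced by `f^{⊗ p}`. -/
noncomputable def coinvFun (p : ℕ) (f : V →ₗ[R] R) : Coinv p R V →ₗ[R] R :=
  Submodule.liftQ _ (powFun p f) (by
    rintro _ ⟨x, rfl⟩
    change powFun p f (x - sigma p R V x) = 0
    rw [map_sub, powFun_sigma, sub_self])

theorem coinvFun_powClass (f : V →ₗ[R] R) (v : V) :
    coinvFun p f (powClass p R V v) = f v ^ p :=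
  powFun_powInv f v

theorem powMap_smulRight (f : V →ₗ[R] R) (w : W) (x : ⨂[R]^p V) :
    powMap p (f.smulRight w) x = powFun p f x • PiTensorProduct.tprod R fun _ => w := by
  suffices powMap p (f.smulRight w) =
      (powFun p f).smulRight (PiTensorProduct.tprod R fun _ => w) from LinearMap.congr_fun this x
  refine PiTensorProduct.ext (MultilinearMap.ext fun v => ?_)
  simp only [LinearMap.compMultilinearMap_apply, powMap, PiTensorProduct.map_tprod,
    LinearMap.smulRight_apply, powFun_tprod]
  exact (PiTensorProduct.tprod R).map_smul_univ (fun i => f (v i)) fun _ => w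

theorem invMap_smulRight (f : V →ₗ[R] R) (w : W) (x : Inv p R V) :
    invMap p (f.smulRight w) x = powFun p f x • powInv p R w :=
  Subtype.ext (powMap_smulRight f w (x : ⨂[R]^p V))

theorem coinvMap_smulRight (f : V →ₗ[R] R) (w : W) (x : Coinv p R V) :
    coinvMap p (f.smulRight w) x = coinvFun p f x • powClass p R W w := by
  obtain ⟨x, rfl⟩ := Submodule.Quotient.mk_surjective _ x
  exact congrArg Submodule.Quotient.mk (powMap_smulRight f w x)

theorem invMap_id (x : Inv p R V) : invMap p (LinearMap.id : V →ₗ[R] V) x = x :=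
  Subtype.ext (powMap_id p _)

theorem coinvMap_id (x : Coinv p R V) : coinvMap p (LinearMap.id : V →ₗ[R] V) x = x := by
  obtain ⟨x, rfl⟩ := Submodule.Quotient.mk_surjective _ x
  exact congrArg Submodule.Quotient.mk (powMap_id p x)

theorem coinvMap_comp {X : Type u} [AddCommGroup X] [Module R X] (h : W →ₗ[R] X) (g : V →ₗ[R] W)
    (x : Coinv p R V) : coinvMap p (h ∘ₗ g) x = coinvMap p h (coinvMap p g x) := by
  obtain ⟨x, rfl⟩ := Submodule.Quotient.mk_surjective _ x
  exact congrArg Submodule.Quotient.mk (powMap_comp p h g x)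

variable (R V) in
theorem exists_sum_smulRight_eq_id [Module.Finite R V] [Module.Projective R V] :
    ∃ (n : ℕ) (f : Fin n → V →ₗ[R] R) (v : Fin n → V),
      ∑ a, (f a).smulRight (v a) = LinearMap.id := by
  obtain ⟨n, e, g, -, -, heg⟩ := Module.Finite.exists_comp_eq_id_of_projective R V
  refine ⟨n, fun a => LinearMap.proj a ∘ₗ g, fun a => e (Pi.single a 1),
    LinearMap.ext fun v => ?_⟩
  calc (∑ a, (LinearMap.proj a ∘ₗ g).smulRight (e (Pi.single a 1))) v
      = e (∑ a, g v a • Pi.single a 1) := by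
        simp only [LinearMap.sum_apply, LinearMap.smulRight_apply, map_sum, map_smul,
          LinearMap.comp_apply, LinearMap.proj_apply]
    _ = v := by rw [← pi_eq_sum_univ' (g v)]; exact LinearMap.congr_fun heg v

end RankOne

section DualBasis

variable {p : ℕ} [Fact p.Prime] {R : Type u} [CommRing R] {V : Type u} [AddCommGroup V]
  [Module R V] {A : Type*} [Fintype A] {f : A → V →ₗ[R] R} {v : A → V}

theorem inv_eq_trace_add_sum (h : ∑ a, (f a).smulRight (v a) = LinearMap.id) (x : Inv p R V) :
    x = trace p R V (crossEffect (fun a => (f a).smulRight (v a)) x) +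
      ∑ a, powFun p (f a) x • powInv p R (v a) := by
  simp only [trace_crossEffect, h, invMap_id, invMap_smulRight, sub_add_cancel]

theorem coinv_eq_crossEffect_add_sum (h : ∑ a, (f a).smulRight (v a) = LinearMap.id)
    (x : Coinv p R V) :
    x = crossEffect (fun a => (f a).smulRight (v a)) (trace p R V x) +
      ∑ a, coinvFun p (f a) x • powClass p R V (v a) := by
  simp only [crossEffect_trace, h, coinvMap_id, coinvMap_smulRight, sub_add_cancel]

end DualBasis

section Exactness

variable {p : ℕ} [Fact p.Prime] {R : Type u} [CommRing R] (hR : (p : R) = 0)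
  {V : Type u} [AddCommGroup V] [Module R V]

theorem psi_tmul (r : R) (v : V) :
    psi hR V (toTwist hR R r ⊗ₜ[R] v) = toTwist hR _ (r • powClass p R V v) := rfl

theorem twistMap_coinvFun_psi (f : V →ₗ[R] R) (y : VTwist hR V) :
    twistMap hR (coinvFun p f) (psi hR V y) = twistFun hR f y := by
  induction y using TensorProduct.induction_on with
  | zero => simp
  | add y z hy hz => simp only [map_add, hy, hz]
  | tmul r v =>
    obtain ⟨r, rfl⟩ := (toTwist hR R).surjective r
    have h : coinvFun p f (r • powClass p R V v) = f v ^ p * r := by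
      rw [map_smul, coinvFun_powClass, smul_eq_mul, mul_comm]
    rw [twistFun_tmul, psi_tmul]
    exact congrArg (toTwist hR R) h

variable [Module.Finite R V] [Module.Projective R V]

theorem psi_injective : Function.Injective (psi hR V) := fun y z h =>
  twistFun_ext hR fun f => by rw [← twistMap_coinvFun_psi, h, twistMap_coinvFun_psi]

theorem psiHat_smul_powInv (r : R) (v : V) :
    psiHat hR V (toTwist hR _ (r • powInv p R v)) = toTwist hR R r ⊗ₜ[R] v := by
  refine twistFun_ext hR fun f => ?_
  rw [twistFun_psiHat, twistFun_tmul, Submodule.coe_smul, map_smul, powFun_powInv, smul_eq_mul,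
    mul_comm]

theorem psiHat_powInv (v : V) : psiHat hR V (toTwist hR _ (powInv p R v)) = frobMap hR V v := by
  rw [← one_smul R (powInv p R v), psiHat_smul_powInv]
  rfl

theorem exists_trace_eq_of_psiHat_eq_zero {x : Inv p R V}
    (hx : psiHat hR V (toTwist hR _ x) = 0) : ∃ y, trace p R V y = x := by
  have hfun (f : V →ₗ[R] R) : powFun p f (x : ⨂[R]^p V) = 0 := by
    have h := twistFun_psiHat hR f x
    rw [hx, map_zero] at h
    exact (toTwist hR R).map_eq_zero_iff.1 h.symm
  obtain ⟨n, f, v, hfv⟩ := exists_sum_smulRight_eq_id R V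
  have h := inv_eq_trace_add_sum hfv x
  simp only [hfun, zero_smul, Finset.sum_const_zero, add_zero] at h
  exact ⟨_, h.symm⟩

theorem psi_psiHat (x : Inv p R V) :
    psi hR V (psiHat hR V (toTwist hR _ x)) =
      toTwist hR _ (Submodule.Quotient.mk (x : ⨂[R]^p V)) := by
  obtain ⟨n, f, v, hfv⟩ := exists_sum_smulRight_eq_id R V
  have hmk : (Submodule.Quotient.mk (x : ⨂[R]^p V) : Coinv p R V) =
      ∑ a, powFun p (f a) x • powClass p R V (v a) := by
    conv_lhs => rw [inv_eq_trace_add_sum hfv x]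
    rw [Submodule.coe_add, Submodule.Quotient.mk_add, mk_trace hR, zero_add,
      ← Submodule.mkQ_apply, AddSubmonoidClass.coe_finsetSum, map_sum]
    rfl
  rw [hmk]
  conv_lhs => rw [inv_eq_trace_add_sum hfv x]
  simp only [map_add, psiHat_trace, zero_add, map_sum, psiHat_smul_powInv, psi_tmul]

theorem exists_psi_eq_of_trace_eq_zero {x : Coinv p R V} (hx : trace p R V x = 0) :
    ∃ y, psi hR V y = toTwist hR _ x := by
  obtain ⟨n, f, v, hfv⟩ := exists_sum_smulRight_eq_id R V
  refine ⟨∑ a, toTwist hR R (coinvFun p (f a) x) ⊗ₜ[R] v a, ?_⟩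
  conv_rhs => rw [coinv_eq_crossEffect_add_sum hfv x, hx, map_zero, zero_add]
  simp only [map_sum, psi_tmul]

end Exactness

section Elementary

theorem RProj.subsingleton_of_isZero {R : Type u} [CommRing R] {V : RProj R}
    (h : Limits.IsZero V) : Subsingleton V.obj := by
  have hid : (𝟙 V : V ⟶ V) = ⟨0⟩ := h.eq_of_src _ _
  exact subsingleton_of_forall_eq 0 fun v => congrArg (fun f : V ⟶ V => f.hom.hom v) hid

theorem subsingleton_tensorPower (p : ℕ) [NeZero p] (R : Type u) [CommRing R] (V : Type u)
    [AddCommGroup V] [Module R V] [Subsingleton V] : Subsingleton (⨂[R]^p V) := by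
  have h : (LinearMap.id : (⨂[R]^p V) →ₗ[R] ⨂[R]^p V) = 0 :=
    PiTensorProduct.ext (MultilinearMap.ext fun v =>
      (PiTensorProduct.tprod R).map_coord_zero (0 : Fin p) (Subsingleton.elim _ _))
  exact subsingleton_of_forall_eq 0 (LinearMap.congr_fun h)

variable {p : ℕ} [Fact p.Prime] {R : Type u} [CommRing R] (hR : (p : R) = 0)

theorem isElementaryExtension_cyclicExtension :
    (cyclicExtension hR).IsElementaryExtension where
  pointed₁ V hV := by
    have := RProj.subsingleton_of_isZero hV
    have := subsingleton_tensorPower p R V.obj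
    have : Subsingleton (Twist hR (Coinv p R V.obj)) :=
      (Submodule.Quotient.mk_surjective _).subsingleton
    exact ModuleCat.isZero_of_subsingleton (ModuleCat.of R (Twist hR (Coinv p R V.obj)))
  pointed₀ V hV := by
    have := RProj.subsingleton_of_isZero hV
    have := subsingleton_tensorPower p R V.obj
    have : Subsingleton (Twist hR (Inv p R V.obj)) :=
      inferInstanceAs (Subsingleton (Inv p R V.obj))
    exact ModuleCat.isZero_of_subsingleton (ModuleCat.of R (fibre hR V))
  injective_b V := psi_injective hR
  exact_b_d V x := by
    constructor
    · intro h
      exact exists_psi_eq_of_trace_eq_zero hR (x := (toTwist hR _).symm x)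
        (congrArg (fun y : fibre hR V => y.1.1) h)
    · rintro ⟨y, rfl⟩
      exact Subtype.ext (Prod.ext (trace_psi hR y) rfl)
  exact_d_a V x := by
    constructor
    · intro (hx : (x : fibre hR V).1.2 = 0)
      have hpsi := (mem_fibre hR).1 (x : fibre hR V).2
      rw [hx, map_zero] at hpsi
      obtain ⟨y, hy⟩ := exists_trace_eq_of_psiHat_eq_zero hR hpsi
      exact ⟨toTwist hR _ y, Subtype.ext (Prod.ext hy hx.symm)⟩
    · rintro ⟨y, rfl⟩
      rfl
  surjective_a V v :=
    ⟨(⟨(toTwist hR _ (powInv p R v), v), (mem_fibre hR).2 (psiHat_powInv (V := V.obj) hR v)⟩ :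
      fibre hR V), rfl⟩

end Elementary

/-! ### Square-zero extensions with a multiplicative section -/

namespace IsSquareZeroExtension

variable {R : Type u} [CommRing R] {M : Type v} [AddCommGroup M] [Module R M]
  {A : Type w} [Ring A] {i : M →+ A} {q : A →+* R}

theorem map_apply_eq_zero (h : IsSquareZeroExtension i q) (m : M) : q (i m) = 0 :=
  (h.exact _).2 ⟨m, rfl⟩

/-- A section `T` of a square-zero extension identifies `R × M` with its total ring, by sending
`(r, m)` to `T r + i m`. -/
noncomputable def sectionEquiv (h : IsSquareZeroExtension i q) {T : R → A}
    (hT : ∀ r, q (T r) = r) : R × M ≃ A :=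
  Equiv.ofBijective (fun x => T x.1 + i x.2) <| by
    refine ⟨fun x y hxy => ?_, fun a => ?_⟩
    · have hfst : x.1 = y.1 := by
        simpa only [map_add, hT, h.map_apply_eq_zero, add_zero] using congrArg q hxy
      refine Prod.ext hfst (h.injective ?_)
      simpa only [hfst, add_right_inj] using hxy
    · obtain ⟨m, hm⟩ := (h.exact (a - T (q a))).1 (by rw [map_sub, hT, sub_self])
      exact ⟨(q a, m), (congrArg (T (q a) + ·) hm).trans (add_sub_cancel _ _)⟩

section

variable (h : IsSquareZeroExtension i q) {T : R → A} (hT : ∀ r, q (T r) = r)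

theorem sectionEquiv_apply (x : R × M) : h.sectionEquiv hT x = T x.1 + i x.2 := rfl

theorem map_sectionEquiv (x : R × M) : q (h.sectionEquiv hT x) = x.1 := by
  rw [sectionEquiv_apply, map_add, hT, h.map_apply_eq_zero, add_zero]

theorem sectionEquiv_add {κ : R → R → M} (hκ : ∀ r s, T (r + s) = T r + T s + i (κ r s))
    (x y : R × M) : h.sectionEquiv hT x + h.sectionEquiv hT y =
      h.sectionEquiv hT (x.1 + y.1, x.2 + y.2 - κ x.1 y.1) := by
  simp only [sectionEquiv_apply, hκ, map_add, map_sub]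
  abel

theorem apply_eq_sectionEquiv {κ : R → R → M} (hκ : ∀ r s, T (r + s) = T r + T s + i (κ r s))
    (m : M) : i m = h.sectionEquiv hT (0, m + κ 0 0) := by
  have hzero : T 0 + i (κ 0 0) = 0 := by
    simpa only [add_zero, add_assoc, left_eq_add] using hκ 0 0
  rw [sectionEquiv_apply, map_add, add_left_comm, hzero, add_zero]

end

theorem sectionEquiv_mul (h : IsSquareZeroExtension i q) {T : R →* A} (hT : ∀ r, q (T r) = r)
    (x y : R × M) : h.sectionEquiv hT x * h.sectionEquiv hT y =
      h.sectionEquiv hT (x.1 * y.1, x.1 • y.2 + y.1 • x.2) := by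
  simp only [sectionEquiv_apply, map_mul, map_add, mul_add, add_mul, h.left_mul, h.right_mul, hT,
    h.map_apply_eq_zero, add_zero]
  abel

theorem exists_ringEquiv {A' : Type*} [Ring A'] {i' : M →+ A'} {q' : A' →+* R}
    (h : IsSquareZeroExtension i q) (h' : IsSquareZeroExtension i' q')
    {T : R →* A} {T' : R →* A'} (hT : ∀ r, q (T r) = r) (hT' : ∀ r, q' (T' r) = r)
    {κ : R → R → M} (hκ : ∀ r s, T (r + s) = T r + T s + i (κ r s))
    (hκ' : ∀ r s, T' (r + s) = T' r + T' s + i' (κ r s)) :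
    ∃ e : A ≃+* A', (∀ m, e (i m) = i' m) ∧ ∀ x, q' (e x) = q x := by
  let E : A ≃ A' := (h.sectionEquiv hT).symm.trans (h'.sectionEquiv hT')
  have hE (x : R × M) : E (h.sectionEquiv hT x) = h'.sectionEquiv hT' x :=
    congrArg (h'.sectionEquiv hT') ((h.sectionEquiv hT).symm_apply_apply x)
  refine ⟨{ E with map_mul' := fun a b => ?_, map_add' := fun a b => ?_ }, fun m => ?_,
    fun a => ?_⟩
  · obtain ⟨x, rfl⟩ := (h.sectionEquiv hT).surjective a
    obtain ⟨y, rfl⟩ := (h.sectionEquiv hT).surjective b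
    change E _ = E _ * E _
    rw [sectionEquiv_mul, hE, hE, hE, sectionEquiv_mul]
  · obtain ⟨x, rfl⟩ := (h.sectionEquiv hT).surjective a
    obtain ⟨y, rfl⟩ := (h.sectionEquiv hT).surjective b
    change E _ = E _ + E _
    rw [sectionEquiv_add h hT hκ, hE, hE, hE, sectionEquiv_add h' hT' hκ']
  · change E (i m) = i' m
    rw [apply_eq_sectionEquiv h hT hκ, hE, apply_eq_sectionEquiv h' hT' hκ']
  · obtain ⟨x, rfl⟩ := (h.sectionEquiv hT).surjective a
    change q' (E _) = _
    rw [hE, map_sectionEquiv, map_sectionEquiv]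

end IsSquareZeroExtension

/-! ### The Teichmüller section of the second Witt vectors -/

section Teichmuller

variable {p : ℕ} [Fact p.Prime] {R : Type*} [CommRing R] {A : Type*} [Fintype A]

variable (p) in
/-- The failure of the Teichmüller map to be additive on the family `c`. -/
noncomputable def teichmullerDefect (c : A → R) : WittVector p R :=
  WittVector.teichmuller p (∑ a, c a) - ∑ a, WittVector.teichmuller p (c a)

theorem teichmullerDefect_coeff_zero (c : A → R) : (teichmullerDefect p c).coeff 0 = 0 := by
  have hcoeff (r : R) : WittVector.constantCoeff (WittVector.teichmuller p r) = r :=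
    WittVector.teichmuller_coeff_zero p r
  change WittVector.constantCoeff (teichmullerDefect p c) = 0
  simp only [teichmullerDefect, map_sub, map_sum, hcoeff, sub_self]

theorem natCast_mul_teichmullerDefect_coeff_one (c : A → R) :
    p * (teichmullerDefect p c).coeff 1 = (∑ a, c a) ^ p - ∑ a, c a ^ p := by
  have hghost : WittVector.ghostComponent 1 (teichmullerDefect p c) =
      (teichmullerDefect p c).coeff 0 ^ p + p * (teichmullerDefect p c).coeff 1 := by
    simp [WittVector.ghostComponent_apply, wittPolynomial_eq_sum_C_mul_X_pow,
      Finset.sum_range_succ]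
  rw [teichmullerDefect_coeff_zero, zero_pow (Fact.out : p.Prime).ne_zero, zero_add] at hghost
  rw [← hghost]
  simp only [teichmullerDefect, map_sub, map_sum, WittVector.ghostComponent_teichmuller, pow_one]

theorem map_teichmullerDefect {S : Type*} [CommRing S] (f : R →+* S) (c : A → R) :
    WittVector.map f (teichmullerDefect p c) = teichmullerDefect p fun a => f (c a) := by
  simp only [teichmullerDefect, map_sub, map_sum, WittVector.map_teichmuller]

/-- Both sides become equal after multiplication by `p`, which is injective for the universal
family, that of the variables of `ℤ[X_a]`. -/
theorem teichmullerDefect_coeff_one (c : A → R) :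
    (teichmullerDefect p c).coeff 1 = powDefect p c := by
  have huniv : (teichmullerDefect p (MvPolynomial.X : A → MvPolynomial A ℤ)).coeff 1 =
      powDefect p MvPolynomial.X := by
    refine mul_left_cancel₀ (Nat.cast_ne_zero.2 (Fact.out : p.Prime).ne_zero) ?_
    rw [natCast_mul_teichmullerDefect_coeff_one, natCast_mul_powDefect]
  let φ : MvPolynomial A ℤ →+* R := MvPolynomial.eval₂Hom (Int.castRingHom R) c
  have hφ : (fun a => φ (MvPolynomial.X a)) = c := funext fun a => MvPolynomial.eval₂Hom_X' _ _ a
  rw [← hφ, ← map_powDefect, ← huniv, ← map_teichmullerDefect, WittVector.map_coeff]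

end Teichmuller

section Witt

variable {p : ℕ} [Fact p.Prime] {R : Type u} [CommRing R] (hR : (p : R) = 0)

variable (p R) in
/-- The multiplicative section `r ↦ (r, 0)` of `W₂(R) → R`. -/
noncomputable def wittSection : R →* TruncatedWittVector p 2 R :=
  (WittVector.truncate 2 : WittVector p R →+* _).toMonoidHom.comp (WittVector.teichmuller p)

theorem truncate_eq_wittIncl {z : WittVector p R} (hz : z.coeff 0 = 0) :
    WittVector.truncate 2 z = wittIncl hR (toTwist hR R (z.coeff 1)) := by
  ext i
  rw [WittVector.coeff_truncate]
  fin_cases i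
  · exact hz
  · rfl

theorem truncate_verschiebung (z : WittVector p R) :
    WittVector.truncate 2 (WittVector.verschiebung z) =
      wittIncl hR (toTwist hR R (z.coeff 0)) := by
  rw [truncate_eq_wittIncl hR (WittVector.verschiebung_coeff_zero z),
    WittVector.verschiebung_coeff_succ z 0]

theorem wittProj_truncate (z : WittVector p R) :
    wittProj p R (WittVector.truncate 2 z) = z.coeff 0 :=
  WittVector.coeff_truncate _ _

theorem wittProj_wittSection (r : R) : wittProj p R (wittSection p R r) = r :=
  (wittProj_truncate _).trans (WittVector.teichmuller_coeff_zero p r)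

theorem wittSection_add (r s : R) : wittSection p R (r + s) =
    wittSection p R r + wittSection p R s + wittIncl hR (toTwist hR R (powDefect p ![r, s])) := by
  have h := truncate_eq_wittIncl hR (teichmullerDefect_coeff_zero (p := p) ![r, s])
  rw [teichmullerDefect_coeff_one, teichmullerDefect, Fin.sum_univ_two, Fin.sum_univ_two, map_sub,
    map_add (WittVector.truncate 2), sub_eq_iff_eq_add'] at h
  exact h

theorem coeff_frobenius_zero (hR : (p : R) = 0) (z : WittVector p R) :
    (WittVector.frobenius z).coeff 0 = z.coeff 0 ^ p := by
  rcases subsingleton_or_nontrivial R with h | h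
  · exact Subsingleton.elim _ _
  · have : CharP R p := (CharP.charP_iff_prime_eq_zero Fact.out).2 hR
    exact WittVector.coeff_frobenius_charP p z 0

theorem wittIncl_mul (m : Twist hR R) (x : TruncatedWittVector p 2 R) :
    wittIncl hR m * x = wittIncl hR (wittProj p R x • m) := by
  obtain ⟨x, rfl⟩ := WittVector.truncate_surjective p 2 R x
  obtain ⟨m, rfl⟩ := (toTwist hR R).surjective m
  have hm := truncate_verschiebung hR (WittVector.teichmuller p m)
  rw [WittVector.teichmuller_coeff_zero] at hm
  rw [← hm, ← map_mul, ← WittVector.verschiebung_mul_frobenius, truncate_verschiebung hR,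
    WittVector.mul_coeff_zero, WittVector.teichmuller_coeff_zero, coeff_frobenius_zero hR,
    wittProj_truncate, smul_toTwist, mul_comm]
  rfl

theorem isSquareZeroExtension_witt : IsSquareZeroExtension (wittIncl hR) (wittProj p R) where
  injective _ _ h := congrArg (TruncatedWittVector.coeff 1) h
  exact x := by
    constructor
    · intro h
      refine ⟨toTwist hR R (x.coeff 1), ?_⟩
      ext i
      fin_cases i
      · exact h.symm
      · rfl
    · rintro ⟨m, rfl⟩
      rfl
  surjective r := ⟨_, wittProj_wittSection r⟩
  right_mul := wittIncl_mul hR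
  left_mul m x := by rw [mul_comm, wittIncl_mul]
  sq_zero m m' := by
    rw [wittIncl_mul, show wittProj p R (wittIncl hR m') = 0 from rfl, zero_smul, map_zero]

end Witt

/-! ### A splitting over abelian groups -/

section BinaryCrossEffect

variable {p : ℕ} [Fact p.Prime] {R : Type u} [CommRing R]
  {V W : Type u} [AddCommGroup V] [Module R V] [AddCommGroup W] [Module R W]

theorem crossEffect_pair_comm (f g : V →ₗ[R] W) (x : Inv p R V) :
    crossEffect ![f, g] x = crossEffect ![g, f] x := by
  rw [← crossEffect_comp_injective (Equiv.swap (0 : Fin 2) 1).injective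
    fun a ha => (ha ((Equiv.swap (0 : Fin 2) 1).surjective a)).elim]
  congr 2
  ext a : 1
  fin_cases a <;> rfl

theorem crossEffect_pair_zero_right (f : V →ₗ[R] W) (x : Inv p R V) :
    crossEffect ![f, 0] x = 0 :=
  crossEffect_eq_zero (a := 0) (by simp [Fin.forall_fin_two]) x

theorem crossEffect_pair_zero_left (f : V →ₗ[R] W) (x : Inv p R V) :
    crossEffect ![0, f] x = 0 :=
  crossEffect_eq_zero (a := 1) (by simp [Fin.forall_fin_two]) x

theorem crossEffect_triple_eq_add_left (f g h : V →ₗ[R] W) (x : Inv p R V) :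
    crossEffect ![f, g, h] x = crossEffect ![f + g, h] x + crossEffect ![f, g] x := by
  rw [crossEffect_eq_add_sum_fiber ![(0 : Fin 2), 0, 1] ![f, g, h], Fin.sum_univ_two]
  have h₀ := crossEffect_comp_injective (ι := ![(0 : Fin 3), 1])
    (g := fun a => if ![(0 : Fin 2), 0, 1] a = 0 then ![f, g, h] a else 0)
    (by decide) (by simp [Fin.forall_fin_succ]) x
  have h₁ := crossEffect_eq_zero (a := 2)
    (g := fun a => if ![(0 : Fin 2), 0, 1] a = 1 then ![f, g, h] a else 0)
    (by simp [Fin.forall_fin_succ]) x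
  rw [← h₀, h₁, add_zero]
  congr 3 <;> ext a : 1 <;> fin_cases a <;> simp [Finset.sum_filter, Fin.sum_univ_three]

theorem crossEffect_triple_eq_add_right (f g h : V →ₗ[R] W) (x : Inv p R V) :
    crossEffect ![f, g, h] x = crossEffect ![f, g + h] x + crossEffect ![g, h] x := by
  rw [crossEffect_eq_add_sum_fiber ![(0 : Fin 2), 1, 1] ![f, g, h], Fin.sum_univ_two]
  have h₀ := crossEffect_eq_zero (a := 0)
    (g := fun a => if ![(0 : Fin 2), 1, 1] a = 0 then ![f, g, h] a else 0)
    (by simp [Fin.forall_fin_succ]) x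
  have h₁ := crossEffect_comp_injective (ι := ![(1 : Fin 3), 2])
    (g := fun a => if ![(0 : Fin 2), 1, 1] a = 1 then ![f, g, h] a else 0)
    (by decide) (by simp [Fin.forall_fin_succ]) x
  rw [← h₁, h₀, zero_add]
  congr 3 <;> ext a : 1 <;> fin_cases a <;> simp [Finset.sum_filter, Fin.sum_univ_three]

end BinaryCrossEffect

section CyclicDefect

variable (p : ℕ) [Fact p.Prime] (R : Type u) [CommRing R]
  {V W : Type u} [AddCommGroup V] [Module R V] [AddCommGroup W] [Module R W]

/-- The canonical class in `(V^{⊗ p})_σ` whose trace is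
`(v + w)^{⊗ p} - v^{⊗ p} - w^{⊗ p}`. -/
noncomputable def cyclicDefect (v w : V) : Coinv p R V :=
  crossEffect ![LinearMap.toSpanSingleton R V v, LinearMap.toSpanSingleton R V w] (powInv p R 1)

theorem cyclicDefect_comm (v w : V) : cyclicDefect p R v w = cyclicDefect p R w v :=
  crossEffect_pair_comm _ _ _

theorem cyclicDefect_zero_right (v : V) : cyclicDefect p R v 0 = 0 := by
  rw [cyclicDefect, LinearMap.toSpanSingleton_zero, crossEffect_pair_zero_right]

theorem cyclicDefect_zero_left (v : V) : cyclicDefect p R 0 v = 0 := by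
  rw [cyclicDefect_comm, cyclicDefect_zero_right]

theorem cyclicDefect_assoc (u v w : V) :
    cyclicDefect p R (u + v) w + cyclicDefect p R u v =
      cyclicDefect p R u (v + w) + cyclicDefect p R v w := by
  simp only [cyclicDefect, LinearMap.toSpanSingleton_add]
  rw [← crossEffect_triple_eq_add_left, crossEffect_triple_eq_add_right]

variable {p R}

theorem coinvMap_cyclicDefect (g : V →ₗ[R] W) (v w : V) :
    coinvMap p g (cyclicDefect p R v w) = cyclicDefect p R (g v) (g w) := by
  rw [cyclicDefect, coinvMap_crossEffect, cyclicDefect]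
  congr 2
  ext a : 1
  fin_cases a <;> exact LinearMap.comp_toSpanSingleton _ _

theorem trace_cyclicDefect (v w : V) : trace p R V (cyclicDefect p R v w) =
    powInv p R (v + w) - (powInv p R v + powInv p R w) := by
  simp [cyclicDefect, trace_crossEffect, invMap_powInv]

end CyclicDefect

section WittPair

/-- The value at `V` of a splitting of the cyclic-power extension: a pair `(v, x)` stands for
`v^{⊗ p} + tr x`, and is added like a Witt vector of length two. -/
@[ext]
structure WittPair (p : ℕ) (R : Type u) [CommRing R] (V : Type u) [AddCommGroup V]
    [Module R V] : Type u where
  vec : V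
  cls : Coinv p R V

namespace WittPair

variable {p : ℕ} {R : Type u} [CommRing R]
  {V W : Type u} [AddCommGroup V] [Module R V] [AddCommGroup W] [Module R W]

noncomputable instance : Zero (WittPair p R V) := ⟨⟨0, 0⟩⟩

theorem vec_zero : (0 : WittPair p R V).vec = 0 := rfl

theorem cls_zero : (0 : WittPair p R V).cls = 0 := rfl

variable [Fact p.Prime]

noncomputable instance : Add (WittPair p R V) :=
  ⟨fun x y => ⟨x.vec + y.vec, x.cls + y.cls - cyclicDefect p R x.vec y.vec⟩⟩

noncomputable instance : Neg (WittPair p R V) :=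
  ⟨fun x => ⟨-x.vec, -x.cls + cyclicDefect p R (-x.vec) x.vec⟩⟩

theorem vec_add (x y : WittPair p R V) : (x + y).vec = x.vec + y.vec := rfl

theorem cls_add (x y : WittPair p R V) :
    (x + y).cls = x.cls + y.cls - cyclicDefect p R x.vec y.vec := rfl

theorem vec_neg (x : WittPair p R V) : (-x).vec = -x.vec := rfl

theorem cls_neg (x : WittPair p R V) :
    (-x).cls = -x.cls + cyclicDefect p R (-x.vec) x.vec := rfl

noncomputable instance : AddCommGroup (WittPair p R V) where
  add_assoc x y z := by
    refine WittPair.ext (add_assoc _ _ _) ?_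
    have h := sub_eq_zero.2 (cyclicDefect_assoc p R x.vec y.vec z.vec)
    simp only [cls_add, vec_add]
    rw [← sub_eq_zero, ← neg_eq_zero, ← h]
    abel
  zero_add x := by
    refine WittPair.ext (zero_add _) ?_
    simp only [cls_add, vec_zero, cls_zero, cyclicDefect_zero_left, zero_add, sub_zero]
  add_zero x := by
    refine WittPair.ext (add_zero _) ?_
    simp only [cls_add, vec_zero, cls_zero, cyclicDefect_zero_right, add_zero, sub_zero]
  add_comm x y := by
    refine WittPair.ext (add_comm _ _) ?_
    simp only [cls_add, cyclicDefect_comm p R x.vec, add_comm x.cls]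
  neg_add_cancel x := by
    refine WittPair.ext (neg_add_cancel _) ?_
    simp only [cls_add, cls_neg, vec_neg, cls_zero]
    abel
  nsmul := nsmulRec
  zsmul := zsmulRec

/-- The map induced by a linear map, `(v, x) ↦ (g v, g^{⊗ p} x)`. -/
noncomputable def map (g : V →ₗ[R] W) : WittPair p R V →+ WittPair p R W :=
  AddMonoidHom.mk' (fun x => ⟨g x.vec, coinvMap p g x.cls⟩) fun x y =>
    WittPair.ext (map_add g _ _) (by
      simp only [cls_add, map_sub, map_add, coinvMap_cyclicDefect])

variable (p R V) in
/-- The inclusion `x ↦ (0, x)`. -/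
noncomputable def ofCoinv : Coinv p R V →+ WittPair p R V :=
  AddMonoidHom.mk' (fun x => ⟨0, x⟩) fun x y => WittPair.ext (add_zero 0).symm (by
    simp only [cls_add, cyclicDefect_zero_right, sub_zero])

variable (p R V) in
/-- The invariant tensor `v^{⊗ p} + tr x` for which the pair `(v, x)` stands. -/
noncomputable def ghost : WittPair p R V →+ Inv p R V :=
  AddMonoidHom.mk' (fun x => powInv p R x.vec + trace p R V x.cls) fun x y => by
    simp only [cls_add, vec_add, map_sub, map_add, trace_cyclicDefect]
    abel

theorem ghost_apply (x : WittPair p R V) :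
    ghost p R V x = powInv p R x.vec + trace p R V x.cls := rfl

theorem ghost_ofCoinv (x : Coinv p R V) : ghost p R V (ofCoinv p R V x) = trace p R V x := by
  have h : powInv p R (0 : V) = 0 :=
    Subtype.ext ((PiTensorProduct.tprod R).map_coord_zero (0 : Fin p) rfl)
  exact (congrArg (· + _) h).trans (zero_add _)

theorem ghost_map (g : V →ₗ[R] W) (x : WittPair p R V) :
    ghost p R W (map g x) = invMap p g (ghost p R V x) := by
  rw [ghost_apply, ghost_apply, map_add, invMap_powInv, ← trace_coinvMap]
  rfl

theorem psiHat_ghost (hR : (p : R) = 0) [Module.Finite R V] [Module.Projective R V]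
    (x : WittPair p R V) :
    psiHat hR V (toTwist hR _ (ghost p R V x)) = frobMap hR V x.vec := by
  rw [ghost_apply, map_add, map_add, psiHat_trace, psiHat_powInv, add_zero]

end WittPair

variable (p : ℕ) [Fact p.Prime] (R : Type u) [CommRing R]

/-- The functor underlying the splitting of the cyclic-power extension by Witt pairs. -/
noncomputable def wittFunctor : RProj R ⥤ AddCommGrpCat.{u} where
  obj V := AddCommGrpCat.of (WittPair p R V.obj)
  map g := AddCommGrpCat.ofHom (WittPair.map g.hom.hom)
  map_id _ := AddCommGrpCat.hom_ext (AddMonoidHom.ext fun x =>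
    WittPair.ext rfl (coinvMap_id (WittPair.cls x)))
  map_comp f g := AddCommGrpCat.hom_ext (AddMonoidHom.ext fun x =>
    WittPair.ext rfl (coinvMap_comp g.hom.hom f.hom.hom (WittPair.cls x)))

theorem isPointed_wittFunctor : IsPointed (wittFunctor p R) := fun V hV => by
  have := RProj.subsingleton_of_isZero hV
  have := subsingleton_tensorPower p R V.obj
  have : Subsingleton (Coinv p R V.obj) := (Submodule.mkQ_surjective _).subsingleton
  have : Subsingleton (WittPair p R V.obj) :=
    ⟨fun x y => WittPair.ext (Subsingleton.elim _ _) (Subsingleton.elim _ _)⟩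
  exact AddCommGrpCat.isZero_of_subsingleton (AddCommGrpCat.of (WittPair p R V.obj))

variable {p R} (hR : (p : R) = 0)

/-- The ghost map with values in `(V^{⊗ p})^σ ×_{V^{(1)}} V`. -/
noncomputable def wittGhost (V : RProj R) : WittPair p R V.obj →+ fibre hR V :=
  AddMonoidHom.mk' (fun x => ⟨(toTwist hR _ (WittPair.ghost p R V.obj x), x.vec),
      (mem_fibre hR).2 (WittPair.psiHat_ghost hR x)⟩)
    fun x y => Subtype.ext (Prod.ext (map_add (WittPair.ghost p R V.obj) x y) rfl)

theorem wittGhost_surjective (V : RProj R) : Function.Surjective (wittGhost hR V) := by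
  rintro ⟨⟨x, v⟩, hxv⟩
  obtain ⟨x, rfl⟩ := (toTwist hR _).surjective x
  obtain ⟨y, hy⟩ := exists_trace_eq_of_psiHat_eq_zero (V := V.obj) hR
    (x := x - powInv p R v) (by
      rw [map_sub, map_sub, psiHat_powInv (V := V.obj) hR, sub_eq_zero]
      exact (mem_fibre hR).1 hxv)
  refine ⟨⟨v, y⟩, Subtype.ext (Prod.ext (congrArg (toTwist hR _) ?_) rfl)⟩
  rw [WittPair.ghost_apply, hy, add_sub_cancel]

/-- The splitting of the cyclic-power extension over abelian groups by Witt pairs. -/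
noncomputable def wittSplitting : Splitting (cyclicExtension hR) where
  C₀₁ := wittFunctor p R
  pointed := isPointed_wittFunctor p R
  c₁ :=
    { app := fun V => AddCommGrpCat.ofHom (WittPair.ofCoinv p R V.obj)
      naturality := fun V W g => AddCommGrpCat.hom_ext (AddMonoidHom.ext fun x =>
        WittPair.ext (map_zero g.hom.hom).symm rfl) }
  c₀ :=
    { app := fun V => AddCommGrpCat.ofHom (wittGhost hR V)
      naturality := fun V W g => AddCommGrpCat.hom_ext (AddMonoidHom.ext fun x =>
        Subtype.ext (Prod.ext (WittPair.ghost_map g.hom.hom x) rfl)) }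
  comm := by
    ext V x
    exact Subtype.ext (Prod.ext (WittPair.ghost_ofCoinv (V := V.obj) x) rfl)
  injective_c₁ V x y h := congrArg WittPair.cls h
  cartesian V x h := by
    obtain ⟨y, hy⟩ := h
    have hvec : WittPair.vec x = 0 := congrArg (fun z : fibre hR V => z.1.2) hy
    exact ⟨WittPair.cls x, WittPair.ext hvec.symm rfl⟩
  surjective_c₀ := wittGhost_surjective hR

end WittPair

/-! ### The ring of regular endomorphisms -/

section RProj

variable {R : Type u} [CommRing R] {V W : RProj R}

/-- A linear map as a morphism of `R-proj`. -/
def RProj.homMk (g : V.obj →ₗ[R] W.obj) : V ⟶ W := ⟨ModuleCat.ofHom g⟩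

variable (R) in
/-- The free module of rank one as an object of `R-proj`. -/
def RProj.unit : RProj R :=
  ⟨ModuleCat.of R R, inferInstanceAs (Module.Finite R R), inferInstanceAs (Module.Projective R R)⟩

/-- The direct sum `V ⊕ V` as an object of `R-proj`. -/
def RProj.double (V : RProj R) : RProj R :=
  ⟨ModuleCat.of R (V.obj × V.obj), inferInstanceAs (Module.Finite R (V.obj × V.obj)),
    inferInstanceAs (Module.Projective R (V.obj × V.obj))⟩

variable (R) in
/-- The zero module as an object of `R-proj`. -/
def RProj.zero : RProj R :=
  ⟨ModuleCat.of R PUnit.{u + 1}, inferInstanceAs (Module.Finite R PUnit.{u + 1}),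
    inferInstanceAs (Module.Projective R PUnit.{u + 1})⟩

theorem RProj.isZero_zero : Limits.IsZero (RProj.zero R) where
  unique_to _ := ⟨⟨⟨RProj.homMk 0⟩, fun f => InducedCategory.hom_ext <| ModuleCat.hom_ext <|
    LinearMap.ext fun v => (congrArg f.hom.hom (Subsingleton.elim (α := PUnit.{u + 1}) v 0)).trans
      (map_zero f.hom.hom)⟩⟩
  unique_from _ := ⟨⟨⟨RProj.homMk 0⟩, fun _ => InducedCategory.hom_ext <| ModuleCat.hom_ext <|
    LinearMap.ext fun _ => Subsingleton.elim (α := PUnit.{u + 1}) _ _⟩⟩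

end RProj

namespace Splitting

section Components

variable {R : Type u} [CommRing R] {M : Type u} [AddCommGroup M] [Module R M] {φ : FourTerm R M}
  (S : Splitting φ) {V W X : RProj R}

/-- The map `c₁` on the objects over `V`. -/
noncomputable def inc (V : RProj R) : φ.C₁.obj V →+ S.C₀₁.obj V := (S.c₁.app V).hom

/-- The map `c₀` on the objects over `V`. -/
noncomputable def proj (V : RProj R) : S.C₀₁.obj V →+ φ.C₀.obj V := (S.c₀.app V).hom

/-- The composite of `c₀` and `a` on the objects over `V`. -/
noncomputable def vec (V : RProj R) : S.C₀₁.obj V →+ V.obj :=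
  (φ.a.app V).hom.toAddMonoidHom.comp (S.proj V)

/-- The action of `C₀₁` on linear maps. -/
noncomputable def mapLin (g : V.obj →ₗ[R] W.obj) : S.C₀₁.obj V →+ S.C₀₁.obj W :=
  (S.C₀₁.map (RProj.homMk g)).hom

theorem mapLin_inc (g : V.obj →ₗ[R] W.obj) (x : φ.C₁.obj V) :
    S.mapLin g (S.inc V x) = S.inc W ((φ.C₁.map (RProj.homMk g)).hom x) :=
  (congrArg (fun f => f.hom x) (S.c₁.naturality (RProj.homMk g))).symm

theorem proj_mapLin (g : V.obj →ₗ[R] W.obj) (y : S.C₀₁.obj V) :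
    S.proj W (S.mapLin g y) = (φ.C₀.map (RProj.homMk g)).hom (S.proj V y) :=
  congrArg (fun f => f.hom y) (S.c₀.naturality (RProj.homMk g))

theorem vec_mapLin (g : V.obj →ₗ[R] W.obj) (y : S.C₀₁.obj V) :
    S.vec W (S.mapLin g y) = g (S.vec V y) :=
  (congrArg (φ.a.app W).hom (S.proj_mapLin g y)).trans
    (congrArg (fun f => f.hom (S.proj V y)) (φ.a.naturality (RProj.homMk g)))

theorem mapLin_id (y : S.C₀₁.obj V) : S.mapLin (V := V) LinearMap.id y = y :=
  congrArg (fun f => f.hom y) (S.C₀₁.map_id V)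

theorem mapLin_comp (h : W.obj →ₗ[R] X.obj) (g : V.obj →ₗ[R] W.obj)
    (y : S.C₀₁.obj V) : S.mapLin (h ∘ₗ g) y = S.mapLin h (S.mapLin g y) :=
  congrArg (fun f => f.hom y) (S.C₀₁.map_comp (RProj.homMk g) (RProj.homMk h))

theorem mapLin_zero (y : S.C₀₁.obj V) : S.mapLin (0 : V.obj →ₗ[R] W.obj) y = 0 := by
  have hzero := S.pointed _ (RProj.isZero_zero (R := R))
  have hfac : S.mapLin (0 : V.obj →ₗ[R] W.obj) y =
      S.mapLin (V := RProj.zero R) 0 (S.mapLin (W := RProj.zero R) 0 y) :=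
    S.mapLin_comp (W := RProj.zero R) 0 0 y
  have := AddCommGrpCat.subsingleton_of_isZero hzero
  rw [hfac, Subsingleton.elim (S.mapLin (W := RProj.zero R) 0 y) 0, map_zero]

theorem proj_inc (x : φ.C₁.obj V) : S.proj V (S.inc V x) = (φ.d.app V).hom x :=
  congrArg (fun f => (f.app V).hom x) S.comm

theorem mapLin_inc_b (g : V.obj →ₗ[R] W.obj) (u : M ⊗[R] V.obj) :
    S.mapLin g (S.inc V ((φ.b.app V).hom u)) =
      S.inc W ((φ.b.app W).hom (LinearMap.lTensor M g u)) :=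
  (S.mapLin_inc g _).trans <| congrArg (S.inc W) <|
    (congrArg (fun f => f.hom u) (φ.b.naturality (RProj.homMk g))).symm

variable {S} (hφ : φ.IsElementaryExtension)
include hφ

theorem exists_vec_eq (S : Splitting φ) (v : V.obj) : ∃ y, S.vec V y = v := by
  obtain ⟨x, hx⟩ := hφ.surjective_a V v
  obtain ⟨y, hy⟩ := S.surjective_c₀ V x
  exact ⟨y, (congrArg (φ.a.app V).hom hy).trans hx⟩

theorem exists_inc_eq {y : S.C₀₁.obj V} (hy : S.vec V y = 0) : ∃ x, S.inc V x = y := by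
  obtain ⟨x, hx⟩ := (hφ.exact_d_a V _).1 hy
  exact S.cartesian V y ⟨x, hx.symm⟩

theorem exists_inc_b_eq {y : S.C₀₁.obj V} (hy : S.proj V y = 0) :
    ∃ u : M ⊗[R] V.obj, S.inc V ((φ.b.app V).hom u) = y := by
  obtain ⟨x, rfl⟩ := exists_inc_eq hφ ((congrArg (φ.a.app V).hom hy).trans (map_zero _))
  obtain ⟨u, rfl⟩ := (hφ.exact_b_d V x).1 ((S.proj_inc x).symm.trans hy)
  exact ⟨u, rfl⟩

theorem inc_b_eq_zero_iff {u : M ⊗[R] V.obj} : S.inc V ((φ.b.app V).hom u) = 0 ↔ u = 0 :=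
  (map_eq_zero_iff (S.inc V) (S.injective_c₁ V)).trans
    (map_eq_zero_iff (φ.b.app V).hom (hφ.injective_b V))

theorem mapLin_add_of_proj_eq_zero (g h : V.obj →ₗ[R] W.obj) {y : S.C₀₁.obj V}
    (hy : S.proj V y = 0) : S.mapLin (g + h) y = S.mapLin g y + S.mapLin h y := by
  obtain ⟨u, rfl⟩ := exists_inc_b_eq hφ hy
  rw [mapLin_inc_b, mapLin_inc_b, mapLin_inc_b, LinearMap.lTensor_add, LinearMap.add_apply]
  exact (congrArg (S.inc W) (map_add (φ.b.app W).hom _ _)).trans (map_add (S.inc W) _ _)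

end Components

section Scalar

variable {R : Type u} [CommRing R] {M : Type u} [AddCommGroup M] [Module R M] {φ : FourTerm R M}
  (S : Splitting φ) {V W : RProj R} {r : R} {f g : End S.C₀₁}

/-- The action of an endomorphism of `C₀₁` on the objects over `V`. -/
def endApp (f : End S.C₀₁) (V : RProj R) : S.C₀₁.obj V →+ S.C₀₁.obj V :=
  ((show S.C₀₁ ⟶ S.C₀₁ from f).app V).hom

variable {S} in
theorem endApp_ext (h : ∀ V y, S.endApp f V y = S.endApp g V y) : f = g :=
  NatTrans.ext (funext fun V => AddCommGrpCat.hom_ext (AddMonoidHom.ext (h V)))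

theorem endApp_mul (f g : End S.C₀₁) (y : S.C₀₁.obj V) :
    S.endApp (f * g) V y = S.endApp f V (S.endApp g V y) := rfl

theorem endApp_mapLin (f : End S.C₀₁) (g : V.obj →ₗ[R] W.obj) (y : S.C₀₁.obj V) :
    S.endApp f W (S.mapLin g y) = S.mapLin g (S.endApp f V y) :=
  congrArg (fun h => h.hom y) ((show S.C₀₁ ⟶ S.C₀₁ from f).naturality (RProj.homMk g))

theorem endApp_inclEnd (m : M) (y : S.C₀₁.obj V) :
    S.endApp (S.inclEnd m) V y = S.inc V ((φ.b.app V).hom (m ⊗ₜ[R] S.vec V y)) := rfl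

theorem isRegularWith_iff : S.IsRegularWith r f ↔
    (∀ V x, S.endApp f V (S.inc V x) = S.inc V (r • x)) ∧
      ∀ V y, S.proj V (S.endApp f V y) = r • S.proj V y where
  mp h := ⟨fun V x => congrArg (fun t => (t.app V).hom x) h.1,
    fun V y => congrArg (fun t => (t.app V).hom y) h.2⟩
  mpr h := ⟨NatTrans.ext (funext fun V => AddCommGrpCat.hom_ext (AddMonoidHom.ext (h.1 V))),
    NatTrans.ext (funext fun V => AddCommGrpCat.hom_ext (AddMonoidHom.ext (h.2 V)))⟩

variable {S} in
theorem IsRegularWith.vec_endApp (h : S.IsRegularWith r f) (y : S.C₀₁.obj V) :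
    S.vec V (S.endApp f V y) = r • S.vec V y :=
  (congrArg (φ.a.app V).hom ((S.isRegularWith_iff.1 h).2 V y)).trans
    (map_smul (φ.a.app V).hom r _)

variable (hφ : φ.IsElementaryExtension)

/-- An element of `C₀₁(R)` lying over `1 : R`. -/
noncomputable def gen : S.C₀₁.obj (RProj.unit R) :=
  Classical.choose (exists_vec_eq hφ S (V := RProj.unit R) (1 : R))

theorem vec_gen : S.vec (RProj.unit R) (S.gen hφ) = (1 : R) :=
  Classical.choose_spec (exists_vec_eq hφ S (V := RProj.unit R) (1 : R))

/-- The scalar by which an endomorphism of `C₀₁` acts on the quotient `V` of `C₀₁(V)`, read off at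
`gen`. It is meaningful for regular endomorphisms only. -/
noncomputable def scalar (f : End S.C₀₁) : R :=
  S.vec (RProj.unit R) (S.endApp f (RProj.unit R) (S.gen hφ))

variable {S} in
theorem IsRegularWith.scalar_eq (h : S.IsRegularWith r f) : S.scalar hφ f = r := by
  refine (h.vec_endApp _).trans ?_
  rw [vec_gen]
  exact mul_one r

theorem isRegularWith_scalar (f : S.regularEnd) : S.IsRegularWith (S.scalar hφ f) f.1 := by
  obtain ⟨f, r, hr⟩ := f
  exact (hr.scalar_eq hφ).symm ▸ hr

variable {S} in
theorem IsRegularWith.eq_of_endApp_gen_eq (hf : S.IsRegularWith r f) (hg : S.IsRegularWith r g)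
    (h : S.endApp f _ (S.gen hφ) = S.endApp g _ (S.gen hφ)) : f = g := by
  refine endApp_ext fun V y => ?_
  let ℓ : (RProj.unit R).obj →ₗ[R] V.obj := LinearMap.toSpanSingleton R V.obj (S.vec V y)
  have hℓ : ℓ (S.vec _ (S.gen hφ)) = S.vec V y :=
    (congrArg ℓ (S.vec_gen hφ)).trans (one_smul R _)
  obtain ⟨x, hx⟩ := exists_inc_eq hφ (y := y - S.mapLin ℓ (S.gen hφ)) <| by
    rw [map_sub, vec_mapLin, hℓ, sub_self]
  have hy : y = S.mapLin ℓ (S.gen hφ) + S.inc V x := by rw [hx, add_sub_cancel]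
  rw [hy, map_add, map_add, endApp_mapLin, endApp_mapLin, h, (S.isRegularWith_iff.1 hf).1,
    (S.isRegularWith_iff.1 hg).1]

/-- The map `R' → R`, `r' ↦ r`. -/
noncomputable def regularProj : S.regularEnd →+* R where
  toFun f := S.scalar hφ f
  map_one' := S.vec_gen hφ
  map_mul' f g := (S.isRegularWith_scalar hφ f).vec_endApp (S.endApp g.1 _ (S.gen hφ))
  map_zero' := map_zero (S.vec _)
  map_add' _ _ := map_add (S.vec _) _ _

theorem isRegularWith_regularProj (f : S.regularEnd) :
    S.IsRegularWith (S.regularProj hφ f) f.1 :=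
  S.isRegularWith_scalar hφ f

theorem regularProj_incl (m : M) : S.regularProj hφ (S.incl m) = 0 :=
  (S.inclEnd_isRegularWith m).scalar_eq hφ

theorem incl_mul (m : M) (f : S.regularEnd) :
    S.incl m * f = S.incl (S.regularProj hφ f • m) :=
  Subtype.ext <| endApp_ext fun V y => by
    change S.endApp (S.inclEnd m * f.1) V y = S.endApp (S.inclEnd (S.regularProj hφ f • m)) V y
    rw [endApp_mul, endApp_inclEnd, endApp_inclEnd,
      (S.isRegularWith_regularProj hφ f).vec_endApp, TensorProduct.smul_tmul]

theorem mul_incl (m : M) (f : S.regularEnd) :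
    f * S.incl m = S.incl (S.regularProj hφ f • m) :=
  Subtype.ext <| endApp_ext fun V y => by
    change S.endApp (f.1 * S.inclEnd m) V y = S.endApp (S.inclEnd (S.regularProj hφ f • m)) V y
    rw [endApp_mul, endApp_inclEnd, endApp_inclEnd,
      (S.isRegularWith_iff.1 (S.isRegularWith_regularProj hφ f)).1, ← TensorProduct.smul_tmul']
    exact congrArg (S.inc V) (map_smul (φ.b.app V).hom _ _).symm

include hφ in
theorem incl_injective : Function.Injective S.incl := by
  rw [injective_iff_map_eq_zero]
  intro m hm
  have h : S.endApp (S.inclEnd m) (RProj.unit R) (S.gen hφ) = 0 :=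
    congrArg (fun f : S.regularEnd => S.endApp f.1 (RProj.unit R) (S.gen hφ)) hm
  rw [endApp_inclEnd, vec_gen, inc_b_eq_zero_iff hφ] at h
  exact (TensorProduct.rid R M).symm.map_eq_zero_iff.1 h

theorem exists_incl_eq {f : S.regularEnd} (hf : S.regularProj hφ f = 0) : ∃ m, S.incl m = f := by
  have hreg : S.IsRegularWith 0 f.1 := hf ▸ S.isRegularWith_regularProj hφ f
  obtain ⟨u, hu⟩ := exists_inc_b_eq hφ (y := S.endApp f.1 _ (S.gen hφ)) <| by
    rw [(S.isRegularWith_iff.1 hreg).2, zero_smul]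
  obtain ⟨m, rfl⟩ := (TensorProduct.rid R M).symm.surjective u
  refine ⟨m, Subtype.ext ((S.inclEnd_isRegularWith m).eq_of_endApp_gen_eq hφ hreg ?_)⟩
  change S.endApp (S.inclEnd m) _ _ = _
  rw [endApp_inclEnd, vec_gen]
  exact hu

theorem isSquareZeroExtension_incl (h : ∀ r : R, ∃ f, S.IsRegularWith r f) :
    IsSquareZeroExtension S.incl (S.regularProj hφ) where
  injective := S.incl_injective hφ
  exact f := ⟨S.exists_incl_eq hφ, by rintro ⟨m, rfl⟩; exact S.regularProj_incl hφ m⟩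
  surjective r := (h r).elim fun f hf => ⟨⟨f, r, hf⟩, hf.scalar_eq hφ⟩
  right_mul := S.incl_mul hφ
  left_mul := S.mul_incl hφ
  sq_zero m m' := by rw [S.incl_mul hφ, regularProj_incl, zero_smul, map_zero]

end Scalar

end Splitting

/-! ### The multiplicative section of the ring of regular endomorphisms -/

section PowMap

variable {R : Type u} [CommRing R] {V : Type u} [AddCommGroup V] [Module R V] {p : ℕ}

theorem powMap_smul_id (r : R) (x : ⨂[R]^p V) :
    powMap p (r • (LinearMap.id : V →ₗ[R] V)) x = r ^ p • x := by
  change PiTensorProduct.mapMultilinear R (fun _ : Fin p => V) (fun _ => V)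
    (fun _ => r • LinearMap.id) x = _
  rw [MultilinearMap.map_smul_univ, PiTensorProduct.mapMultilinear_apply,
    PiTensorProduct.map_id, Finset.prod_const, Finset.card_univ, Fintype.card_fin]
  rfl

end PowMap

namespace Splitting

section Scale

variable {R : Type u} [CommRing R] {M : Type u} [AddCommGroup M] [Module R M] {φ : FourTerm R M}
  (S : Splitting φ)

/-- The endomorphism of `C₀₁` induced by the multiplication by `r` on the modules `V`. -/
noncomputable def scaleEnd (r : R) : End S.C₀₁ :=
  show S.C₀₁ ⟶ S.C₀₁ from
  { app := fun V => S.C₀₁.map (RProj.homMk (V := V) (W := V) (r • LinearMap.id))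
    naturality := fun V W g => by
      rw [← S.C₀₁.map_comp, ← S.C₀₁.map_comp]
      exact congrArg S.C₀₁.map <| InducedCategory.hom_ext <| ModuleCat.hom_ext <|
        LinearMap.ext fun v => (g.hom.hom.map_smul r v).symm }

theorem endApp_scaleEnd (r : R) (V : RProj R) (y : S.C₀₁.obj V) :
    S.endApp (S.scaleEnd r) V y = S.mapLin (V := V) (r • LinearMap.id) y := rfl

theorem scaleEnd_one : S.scaleEnd 1 = 1 :=
  endApp_ext fun V y => by
    rw [endApp_scaleEnd, one_smul, mapLin_id]
    rfl

theorem scaleEnd_mul (r s : R) : S.scaleEnd (r * s) = S.scaleEnd r * S.scaleEnd s :=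
  endApp_ext fun V y => by
    rw [endApp_mul, endApp_scaleEnd, endApp_scaleEnd, endApp_scaleEnd, ← mapLin_comp,
      LinearMap.smul_comp, LinearMap.comp_smul, LinearMap.id_comp, smul_smul]

end Scale

section Cyclic

variable {p : ℕ} [Fact p.Prime] {R : Type u} [CommRing R] {hR : (p : R) = 0}
  (S : Splitting (cyclicExtension hR)) {V W X : RProj R}

/-- The invariant tensor underlying an element of `C₀₁`. -/
noncomputable def tensor (V : RProj R) : S.C₀₁.obj V →+ Inv p R V.obj :=
  (toTwist hR _).symm.toAddMonoidHom.comp <|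
    (LinearMap.fst R (Twist hR (Inv p R V.obj)) V.obj ∘ₗ
      (fibre hR V).subtype).toAddMonoidHom.comp (S.proj V)

theorem tensor_mapLin (g : V.obj →ₗ[R] W.obj) (y : S.C₀₁.obj V) :
    S.tensor W (S.mapLin g y) = invMap p g (S.tensor V y) :=
  congrArg (fun z : fibre hR W => z.1.1) (S.proj_mapLin g y)

/-- The map `c₁`, on coinvariants without the Frobenius twist. -/
noncomputable def ofCoinv (V : RProj R) : Coinv p R V.obj →+ S.C₀₁.obj V :=
  (S.inc V).comp (toTwist hR _).toAddMonoidHom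

theorem mapLin_ofCoinv (g : V.obj →ₗ[R] W.obj) (x : Coinv p R V.obj) :
    S.mapLin g (S.ofCoinv V x) = S.ofCoinv W (coinvMap p g x) :=
  S.mapLin_inc g _

theorem tensor_ofCoinv (x : Coinv p R V.obj) :
    S.tensor V (S.ofCoinv V x) = trace p R V.obj x :=
  congrArg (fun z : fibre hR V => z.1.1) (S.proj_inc (toTwist hR _ x))

theorem vec_ofCoinv (x : Coinv p R V.obj) : S.vec V (S.ofCoinv V x) = 0 :=
  congrArg (fun z : fibre hR V => z.1.2) (S.proj_inc (toTwist hR _ x))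

/-- The failure of `f ↦ C₀₁(f)` to be additive at `f` and `g`, corrected by the cross effect of the
trace complex. -/
noncomputable def addDefect (f g : V.obj →ₗ[R] W.obj) (y : S.C₀₁.obj V) : S.C₀₁.obj W :=
  S.mapLin (f + g) y - S.mapLin f y - S.mapLin g y -
    S.ofCoinv W (crossEffect ![f, g] (S.tensor V y))

theorem proj_addDefect (f g : V.obj →ₗ[R] W.obj) (y : S.C₀₁.obj V) :
    S.proj W (S.addDefect f g y) = 0 := by
  have htensor : S.tensor W (S.addDefect f g y) = 0 := by
    rw [addDefect, map_sub, map_sub, map_sub, tensor_mapLin, tensor_mapLin, tensor_mapLin,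
      tensor_ofCoinv, trace_crossEffect, Fin.sum_univ_two, Fin.sum_univ_two]
    simp only [Matrix.cons_val_zero, Matrix.cons_val_one]
    abel
  have hvec : S.vec W (S.addDefect f g y) = 0 := by
    rw [addDefect, map_sub, map_sub, map_sub, vec_mapLin, vec_mapLin, vec_mapLin, vec_ofCoinv,
      LinearMap.add_apply]
    abel
  exact Subtype.ext (Prod.ext htensor hvec)

theorem mapLin_addDefect (h : W.obj →ₗ[R] X.obj) (f g : V.obj →ₗ[R] W.obj) (y : S.C₀₁.obj V) :
    S.mapLin h (S.addDefect f g y) = S.addDefect (h ∘ₗ f) (h ∘ₗ g) y := by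
  have hpair : (fun a => h ∘ₗ ![f, g] a) = ![h ∘ₗ f, h ∘ₗ g] :=
    funext (Fin.forall_fin_two.2 ⟨rfl, rfl⟩)
  rw [addDefect, map_sub, map_sub, map_sub, mapLin_ofCoinv, coinvMap_crossEffect, hpair,
    ← mapLin_comp, ← mapLin_comp, ← mapLin_comp, LinearMap.comp_add, addDefect]

theorem addDefect_zero_right (f : V.obj →ₗ[R] W.obj) (y : S.C₀₁.obj V) :
    S.addDefect f 0 y = 0 := by
  rw [addDefect, crossEffect_pair_zero_right, mapLin_zero, add_zero, map_zero, sub_self, sub_zero,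
    sub_zero]

theorem addDefect_zero_left (f : V.obj →ₗ[R] W.obj) (y : S.C₀₁.obj V) :
    S.addDefect 0 f y = 0 := by
  rw [addDefect, crossEffect_pair_zero_left, mapLin_zero, zero_add, map_zero, sub_zero, sub_zero,
    sub_self]

/-- Naturality reduces this to the two inclusions `V → V ⊕ V`. Their defect comes from `I(R^{(1)})`,
where `C₀₁` is additive, and is killed by both projections because one of the two composites
vanishes. -/
theorem addDefect_eq_zero (f g : V.obj →ₗ[R] W.obj) (y : S.C₀₁.obj V) :
    S.addDefect f g y = 0 := by
  let i₁ : V.obj →ₗ[R] V.double.obj := LinearMap.inl R V.obj V.obj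
  let i₂ : V.obj →ₗ[R] V.double.obj := LinearMap.inr R V.obj V.obj
  let q₁ : V.double.obj →ₗ[R] V.obj := LinearMap.fst R V.obj V.obj
  let q₂ : V.double.obj →ₗ[R] V.obj := LinearMap.snd R V.obj V.obj
  let h : V.double.obj →ₗ[R] W.obj := LinearMap.coprod f g
  have hsum : i₁ ∘ₗ q₁ + i₂ ∘ₗ q₂ = LinearMap.id :=
    LinearMap.ext fun x => Prod.ext (add_zero _) (zero_add _)
  have h₁ : S.mapLin q₁ (S.addDefect i₁ i₂ y) = 0 :=
    (S.mapLin_addDefect q₁ i₁ i₂ y).trans (S.addDefect_zero_right LinearMap.id y)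
  have h₂ : S.mapLin q₂ (S.addDefect i₁ i₂ y) = 0 :=
    (S.mapLin_addDefect q₂ i₁ i₂ y).trans (S.addDefect_zero_left LinearMap.id y)
  have huniv : S.addDefect i₁ i₂ y = 0 := by
    rw [← S.mapLin_id (S.addDefect i₁ i₂ y), ← hsum,
      mapLin_add_of_proj_eq_zero (isElementaryExtension_cyclicExtension hR) _ _
        (S.proj_addDefect i₁ i₂ y),
      mapLin_comp, mapLin_comp, h₁, h₂, map_zero, map_zero, add_zero]
  have hf : h ∘ₗ i₁ = f := LinearMap.coprod_inl f g
  have hg : h ∘ₗ i₂ = g := LinearMap.coprod_inr f g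
  rw [← hf, ← hg, ← mapLin_addDefect, huniv, map_zero]

theorem mapLin_add (f g : V.obj →ₗ[R] W.obj) (y : S.C₀₁.obj V) :
    S.mapLin (f + g) y = S.mapLin f y + S.mapLin g y +
      S.ofCoinv W (crossEffect ![f, g] (S.tensor V y)) := by
  have h := S.addDefect_eq_zero f g y
  rwa [addDefect, sub_sub, sub_eq_zero, sub_eq_iff_eq_add', ← add_assoc] at h

theorem isRegularWith_scaleEnd (r : R) : S.IsRegularWith r (S.scaleEnd r) := by
  refine S.isRegularWith_iff.2 ⟨fun V x => ?_, fun V y => ?_⟩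
  · obtain ⟨x, rfl⟩ := (toTwist hR (Coinv p R V.obj)).surjective x
    obtain ⟨x, rfl⟩ := Submodule.Quotient.mk_surjective _ x
    exact (S.mapLin_ofCoinv _ _).trans
      (congrArg (fun t => S.ofCoinv V (Submodule.Quotient.mk t)) (powMap_smul_id r x))
  · rw [endApp_scaleEnd, proj_mapLin]
    exact Subtype.ext (Prod.ext (Subtype.ext (powMap_smul_id r _)) rfl)

/-- The multiplicative section `r ↦ C₀₁(r)` of `R' → R`. -/
noncomputable def regularSection : R →* S.regularEnd where
  toFun r := ⟨S.scaleEnd r, r, S.isRegularWith_scaleEnd r⟩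
  map_one' := Subtype.ext S.scaleEnd_one
  map_mul' r s := Subtype.ext (S.scaleEnd_mul r s)

theorem regularProj_regularSection (r : R) :
    S.regularProj (isElementaryExtension_cyclicExtension hR) (S.regularSection r) = r :=
  (S.isRegularWith_scaleEnd r).scalar_eq _

theorem psi_tmul_vec (r : R) (y : S.C₀₁.obj V) :
    psi hR V.obj (toTwist hR R r ⊗ₜ[R] S.vec V y) =
      toTwist hR _ (r • Submodule.Quotient.mk (S.tensor V y : ⨂[R]^p V.obj)) := by
  have hfib : psiHat hR V.obj (toTwist hR _ (S.tensor V y)) = frobMap hR V.obj (S.vec V y) :=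
    (mem_fibre hR).1 (S.proj V y).2
  have hone : powClass p R V.obj (S.vec V y) =
      Submodule.Quotient.mk (S.tensor V y : ⨂[R]^p V.obj) := by
    rw [← one_smul R (powClass p R V.obj (S.vec V y))]
    refine (toTwist hR _).injective ((psi_tmul hR 1 _).symm.trans ?_)
    exact (congrArg (psi hR V.obj) hfib.symm).trans (psi_psiHat hR _)
  rw [psi_tmul, hone]

theorem regularSection_add (r s : R) : S.regularSection (r + s) =
    S.regularSection r + S.regularSection s + S.incl (toTwist hR R (powDefect p ![r, s])) :=
  Subtype.ext <| endApp_ext fun V y => by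
    have hpair : ![r • (LinearMap.id : V.obj →ₗ[R] V.obj), s • LinearMap.id] =
        fun a => ![r, s] a • LinearMap.id := funext (Fin.forall_fin_two.2 ⟨rfl, rfl⟩)
    change S.mapLin ((r + s) • LinearMap.id) y =
      S.mapLin (r • LinearMap.id) y + S.mapLin (s • LinearMap.id) y +
        S.inc V (psi hR V.obj (toTwist hR R (powDefect p ![r, s]) ⊗ₜ[R] S.vec V y))
    rw [add_smul, mapLin_add, hpair, crossEffect_smul_id, psi_tmul_vec]
    rfl

end Cyclic

end Splitting

end CyclicPower

theorem mainTheorem4 (p : ℕ) [Fact p.Prime] (R : Type*) [CommRing R] (hR : (p : R) = 0) :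
    -- the Frobenius pullback of the trace complex is an elementary extension of `R` by `R^{(1)}`
    (CyclicPower.cyclicExtension hR).IsElementaryExtension ∧
    -- `W₂(R)` is a square-zero extension of `R` by `R^{(1)}`
    CyclicPower.IsSquareZeroExtension (CyclicPower.wittIncl hR) (CyclicPower.wittProj p R) ∧
    -- the associated extension of functors to abelian groups admits a splitting
    Nonempty (CyclicPower.Splitting (CyclicPower.cyclicExtension hR)) ∧
    -- for any splitting, the ring of regular endomorphisms is a square-zero extension of `R` by
    -- `R^{(1)}`, isomorphic to `W₂(R)` as a square-zero extension
    ∀ S : CyclicPower.Splitting (CyclicPower.cyclicExtension hR),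
      ∃ q : S.regularEnd →+* R,
        (∀ f : S.regularEnd, S.IsRegularWith (q f) f) ∧
        CyclicPower.IsSquareZeroExtension S.incl q ∧
        ∃ e : S.regularEnd ≃+* TruncatedWittVector p 2 R,
          (∀ m : CyclicPower.Twist hR R, e (S.incl m) = CyclicPower.wittIncl hR m) ∧
          ∀ f : S.regularEnd, CyclicPower.wittProj p R (e f) = q f := by
  have hφ := CyclicPower.isElementaryExtension_cyclicExtension hR
  have hW := CyclicPower.isSquareZeroExtension_witt hR
  refine ⟨hφ, hW, ⟨CyclicPower.wittSplitting hR⟩, fun S => ?_⟩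
  have hS := S.isSquareZeroExtension_incl hφ fun r => ⟨_, S.isRegularWith_scaleEnd r⟩
  exact ⟨S.regularProj hφ, S.isRegularWith_regularProj hφ, hS,
    hS.exists_ringEquiv hW S.regularProj_regularSection CyclicPower.wittProj_wittSection
      S.regularSection_add (CyclicPower.wittSection_add hR)⟩
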